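/- **Theorem.** *Definitions.* A permutation $\sigma$ of length $n=|\sigma|$ is a bijection of $\{1,\dots,n\}$. A set of indices $K=\{i_1<\dots<i_k\}$ is an occurrence of a pattern $\pi$ of length $k$ in $\sigma$ if $\sigma(i_1)\cdots\sigma(i_k)$ is order-isomorphic to $\pi$; the width of $K$ is $i_k-i_1+1$. The global density $\rho(\pi,\sigma)$ is the number of occurrences of $\pi$ in $\sigma$ divided by $\binom nk$. For a real number $w$, $\rho_w(\pi,\sigma)$ is the number of occurrences of $\pi$ in $\sigma$ of width at most $w$ divided by the number of $k$-element subsets of $\{1,\dots,n\}$ of width at most $w$. Write $f\ll g$ if $f(n)/g(n)\to0$ as $n\to\infty$. A *scaling function* is an $f$ with $0<f(n)\le n$ for all $n\ge1$ and $1\ll f\ll n$. Let $(\sigma_j)$ be a sequence of permutations with $|\sigma_j|\to\infty$. - $(\sigma_j)$ converges at scale $f$ to a real vector $\Xi=(\Xi_\pi)$, indexed by all permutations $\pi$, if $\rho_{f(|\sigma_j|)}(\pi,\sigma_j)\to\Xi_\pi$ for every $\pi$. A *scale limit* is a vector $\Xi$ to which some sequence of permutations converges at scale $f$ for some scaling function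 $f$. - A *permuton* is a Borel probability measure $\Gamma$ on $[0,1]^2$ with uniform marginals, and $\rho(\pi,\Gamma)$ is the probability that $|\pi|$ independent $\Gamma$-distributed points, listed by increasing first coordinate, have second coordinates order-isomorphic to $\pi$. $(\sigma_j)$ converges globally to $\Gamma$ if $\rho(\pi,\sigma_j)\to\rho(\pi,\Gamma)$ for every $\pi$. - A *permutation local limit* is a shift-invariant random infinite rooted permutation $\Lambda$, that is, a random total order on $\mathbb Z$ whose law is invariant under the shift of $\mathbb Z$. $(\sigma_j)$ converges locally to $\Lambda$ if, for every $\pi$, $\rho_{|\pi|}(\pi,\sigma_j)$ tends to the probability that $\Lambda$ induces the pattern $\pi$ on the indices $0,1,\dots,|\pi|-1$. *Statement.* Let $(f_t)_{t\in\mathbb N}$ be scaling functions totally ordered by domination: for all $s\ne t$, $f_s\ll f_t$ or $f_t\ll f_s$. For each $t\in\mathbb N$, let $\Xi_t$ and $\Xi'_t$ be any scale limits. Let $\Gamma$ be any permuton, and let $\Lambda$ and $\Lambda'$ be any permutation local limits. Then there exists a sequence of permutations $(\tau_j)_{j\in\mathbb N}$ which converges to $\Xi_t$ at scale $f_t$ for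 every $t$, converges globally to $\Gamma$, and converges locally to $\Lambda$, and whose inverse sequence $(\tau_j^{-1})_{j\in\mathbb N}$ converges to $\Xi'_t$ at scale $f_t$ for every $t$ and converges locally to $\Lambda'$. -/

import Mathlib

open Filter Topology MeasureTheory

noncomputable section

namespace PermScale

/-- A finite permutation: a length `n` together with a permutation of `n` (0-based) indices. -/
abbrev Permutation : Type := Σ n : ℕ, Equiv.Perm (Fin n)

/-- The length of a permutation. -/
def Permutation.length (σ : Permutation) : ℕ := σ.1

/-- The inverse permutation. -/
def Permutation.inverse (σ : Permutation) : Permutation := ⟨σ.1, σ.2.symm⟩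

/-- The width `i_k - i_1 + 1` of a nonempty set of indices `i_1 < ... < i_k`
(and `0` for the empty set). -/
def width {n : ℕ} (K : Finset (Fin n)) : ℕ :=
  if h : K.Nonempty then (K.max' h : ℕ) - (K.min' h : ℕ) + 1 else 0

/-- The set of indices `K` is an occurrence of the pattern `π` in `σ`: it has `|π|` elements
`i_0 < i_1 < ...`, and `σ(i_0) σ(i_1) ...` is order-isomorphic to `π`. -/
def IsOccurrence (π σ : Permutation) (K : Finset (Fin σ.1)) : Prop :=
  ∃ h : K.card = π.1, ∀ a b : Fin π.1,
    σ.2 (K.orderEmbOfFin h a) < σ.2 (K.orderEmbOfFin h b) ↔ π.2 a < π.2 b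

/-- The number of occurrences of `π` in `σ`. -/
def occ (π σ : Permutation) : ℕ :=
  Set.ncard {K : Finset (Fin σ.1) | IsOccurrence π σ K}

/-- The global density of `π` in `σ`. -/
def density (π σ : Permutation) : ℝ :=
  (occ π σ : ℝ) / (Nat.choose σ.1 π.1 : ℝ)

/-- The number of occurrences of `π` in `σ` of width at most `f`. -/
def occAt (f : ℝ) (π σ : Permutation) : ℕ :=
  Set.ncard {K : Finset (Fin σ.1) | IsOccurrence π σ K ∧ (width K : ℝ) ≤ f}

/-- The number of `k`-element sets of indices, out of `n` indices, of width at most `f`. -/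
def chooseAt (f : ℝ) (n k : ℕ) : ℕ :=
  Set.ncard {K : Finset (Fin n) | K.card = k ∧ (width K : ℝ) ≤ f}

/-- The density of `π` in `σ` at scale `f` (here `f` is a number). -/
def densityAt (f : ℝ) (π σ : Permutation) : ℝ :=
  (occAt f π σ : ℝ) / (chooseAt f σ.1 π.1 : ℝ)

/-- The local density of `π` in `σ`: the density of consecutive occurrences. -/
def localDensity (π σ : Permutation) : ℝ := densityAt (π.1 : ℝ) π σ

/-- `f ≪ g`: the ratio `f(n) / g(n)` tends to `0`. -/
def Dominated (f g : ℕ → ℝ) : Prop :=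
  Tendsto (fun n => f n / g n) atTop (𝓝 0)

/-- Scaling functions: `f` takes positive values, `f(n) ≤ n` for all `n ≥ 1`, and `1 ≪ f ≪ n`.
The value at `0` is irrelevant. -/
structure IsScalingFunction (f : ℕ → ℝ) : Prop where
  pos : ∀ n, 1 ≤ n → 0 < f n
  le_self : ∀ n, 1 ≤ n → f n ≤ n
  one_dominated : Dominated (fun _ => 1) f
  dominated_id : Dominated f (fun n => (n : ℝ))

/-- The lengths of the permutations in the sequence tend to infinity. -/
def LengthsTendToInfinity (σ : ℕ → Permutation) : Prop :=
  Tendsto (fun j => (σ j).length) atTop atTop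

/-- The sequence `σ` converges at scale `f` to the vector `Ξ`, indexed by all permutations. -/
def ConvergesAtScale (f : ℕ → ℝ) (σ : ℕ → Permutation) (Ξ : Permutation → ℝ) : Prop :=
  LengthsTendToInfinity σ ∧
    ∀ π : Permutation, Tendsto (fun j => densityAt (f (σ j).length) π (σ j)) atTop (𝓝 (Ξ π))

/-- Scale limits: limits of sequences of permutations convergent at some scale. -/
def IsScaleLimit (Ξ : Permutation → ℝ) : Prop :=
  ∃ (f : ℕ → ℝ) (σ : ℕ → Permutation), IsScalingFunction f ∧ ConvergesAtScale f σ Ξ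

/-- Permutons: Borel probability measures on the unit square with uniform marginals. -/
structure Permuton where
  /-- the underlying measure -/
  measure : Measure (unitInterval × unitInterval)
  isProbabilityMeasure : IsProbabilityMeasure measure
  fst_uniform : ∀ a b : unitInterval, a ≤ b →
    measure (Set.Icc a b ×ˢ Set.univ) = ENNReal.ofReal ((b : ℝ) - (a : ℝ))
  snd_uniform : ∀ a b : unitInterval, a ≤ b →
    measure (Set.univ ×ˢ Set.Icc a b) = ENNReal.ofReal ((b : ℝ) - (a : ℝ))

/-- The points `p` in the square induce the pattern `π`: when they are listed (through `s`) by
increasing first coordinate, their second coordinates are order-isomorphic to `π`. -/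
def InducesPattern (π : Permutation) (p : Fin π.1 → unitInterval × unitInterval) : Prop :=
  ∃ s : Equiv.Perm (Fin π.1), StrictMono (fun a => (p (s a)).1) ∧
    ∀ a b : Fin π.1, (p (s a)).2 < (p (s b)).2 ↔ π.2 a < π.2 b

/-- The density of `π` in the permuton `Γ`: the probability that `|π|` independent points
distributed according to `Γ` induce `π`. -/
def Permuton.density (Γ : Permuton) (π : Permutation) : ℝ :=
  (Measure.pi (fun _ : Fin π.1 => Γ.measure)).real {p | InducesPattern π p}

/-- The sequence `σ` converges globally to the permuton `Γ`. -/
def ConvergesGlobally (σ : ℕ → Permutation) (Γ : Permuton) : Prop :=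
  LengthsTendToInfinity σ ∧
    ∀ π : Permutation, Tendsto (fun j => PermScale.density π (σ j)) atTop (𝓝 (Γ.density π))

/-- Infinite permutations, i.e. (strict) total orders on `ℤ`, rooted at the integer `0`;
`r i j` says that the value at index `i` is below the value at index `j`.
They carry the σ-algebra generated by the events `r i j`. -/
abbrev InfiniteRootedPermutation : Type :=
  {r : ℤ → ℤ → Prop // (∀ i, ¬ r i i) ∧ (∀ i j k, r i j → r j k → r i k) ∧
    (∀ i j, i ≠ j → r i j ∨ r j i)}

/-- Moving the root by one place. -/
def InfiniteRootedPermutation.shift (r : InfiniteRootedPermutation) :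
    InfiniteRootedPermutation :=
  ⟨fun i j => r.1 (i + 1) (j + 1), fun i => r.2.1 (i + 1),
    fun i j k => r.2.2.1 (i + 1) (j + 1) (k + 1),
    fun i j h => r.2.2.2 (i + 1) (j + 1) (fun h' => h (add_right_cancel h'))⟩

/-- (The law of) a shift-invariant random infinite rooted permutation. -/
structure SIRIRP where
  /-- the law -/
  measure : Measure InfiniteRootedPermutation
  isProbabilityMeasure : IsProbabilityMeasure measure
  shift_invariant :
    MeasurePreserving InfiniteRootedPermutation.shift measure measure

/-- The probability that the consecutive indices `0, 1, ..., |π| - 1` (by shift invariance, any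
`|π|` consecutive indices) of the random infinite permutation induce the pattern `π`. -/
def SIRIRP.density (Λ : SIRIRP) (π : Permutation) : ℝ :=
  Λ.measure.real {r | ∀ a b : Fin π.1, r.1 ((a : ℕ) : ℤ) ((b : ℕ) : ℤ) ↔ π.2 a < π.2 b}

/-- The sequence `σ` converges locally to the local limit `Λ`. -/
def ConvergesLocally (σ : ℕ → Permutation) (Λ : SIRIRP) : Prop :=
  LengthsTendToInfinity σ ∧
    ∀ π : Permutation, Tendsto (fun j => localDensity π (σ j)) atTop (𝓝 (Λ.density π))

end PermScale

end

/-! Only lower bounds have to be proved. For fixed k, the densities of the patterns of length k sum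
to 1, both in a long permutation and in each prescribed limit, so an asymptotic lower bound for
every one of them forces convergence (`tendsto_of_lower_bound`). Lower bounds are easy to produce,
because occurrences inside disjoint intervals of indices may simply be added (`sum_occAt_le`) and
all others ignored.

The scales are separated by nested inflation. If every point of `S` is replaced by a copy of `D`,
patterns at scales small compared with `|D|` can be found inside the copies, while choosing one
point in each of several blocks turns occurrences of width v in `S` into occurrences of width at
most v|D| (`pow_mul_occAt_le_inflate`). Inflation commutes with inversion, so both limits are
handled at once. The innermost level carries the local limits; the scales follow in increasing order
of growth (`eventually_exists_allGood`); the outermost level approximates Γ. Each level uses a fixed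
`S`, and `D` consists of many copies of the previous permutation, padded to the required length.
Domination makes the previous permutation short enough for the padding to be negligible.

At each level below the global one, the limits of the permutation and of its inverse can be
prescribed independently: a grid built from `A` and `B` has `A` on intervals of indices and `B` on
intervals of values (`exists_scaleGood_both`).

The building blocks are a late term of a sequence converging to the scale limit, a direct sum of
finite windows distributed nearly as Λ (`SIRIRP.exists_localGood`), and a random sample of Γ,
controlled by its second moment (`Permuton.exists_occ_ge`). Finitely many scales and patterns are
treated at a time, and a diagonal choice gives the sequence. -/

namespace PermScale

/-! ### Occurrences as strictly increasing maps -/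

/-- The occurrences of `π` in `σ` of width at most `w`, as strictly increasing maps. -/
def occMaps (w : ℝ) (π σ : Permutation) : Set (Fin π.1 → Fin σ.1) :=
  {e | StrictMono e ∧ (∀ a b, σ.2 (e a) < σ.2 (e b) ↔ π.2 a < π.2 b) ∧
    ∀ a b, ((e b : ℕ) : ℝ) + 1 ≤ (e a : ℕ) + w}

theorem width_le_iff {n k : ℕ} {w : ℝ} (hw : 0 ≤ w) (e : Fin k → Fin n) :
    (width (Finset.univ.image e) : ℝ) ≤ w ↔ ∀ a b, ((e b : ℕ) : ℝ) + 1 ≤ (e a : ℕ) + w := by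
  unfold width
  split_ifs with h
  · have hmin := Finset.min'_mem _ h
    have hmax := Finset.max'_mem _ h
    have hle := Finset.min'_le_max' _ h
    rw [Finset.mem_image] at hmin hmax
    obtain ⟨a, -, ha⟩ := hmin
    obtain ⟨b, -, hb⟩ := hmax
    have hle' : (((Finset.univ.image e).min' h : Fin n) : ℕ) ≤
      ((Finset.univ.image e).max' h : Fin n) := hle
    push_cast [Nat.cast_sub hle']
    constructor
    · intro H c d
      have h1 : ((Finset.univ.image e).min' h : ℕ) ≤ e c :=
        Finset.min'_le _ _ (Finset.mem_image_of_mem e (Finset.mem_univ c))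
      have h2 : (e d : ℕ) ≤ ((Finset.univ.image e).max' h : Fin n) :=
        Finset.le_max' _ _ (Finset.mem_image_of_mem e (Finset.mem_univ d))
      have h1' : (((Finset.univ.image e).min' h : ℕ) : ℝ) ≤ (e c : ℕ) := by exact_mod_cast h1
      have h2' : ((e d : ℕ) : ℝ) ≤ ((Finset.univ.image e).max' h : ℕ) := by exact_mod_cast h2
      linarith
    · intro H
      have := H a b
      rw [ha, hb] at this
      linarith
  -- The empty image has width 0 by convention, which is where `hw` is needed; the right side is
  -- vacuous.
  · simp only [Nat.cast_zero, hw, true_iff]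
    intro a
    exact absurd ⟨e a, Finset.mem_image_of_mem e (Finset.mem_univ a)⟩ h

theorem isOccurrence_image_iff {π σ : Permutation} {e : Fin π.1 → Fin σ.1} (he : StrictMono e) :
    IsOccurrence π σ (Finset.univ.image e) ↔
      ∀ a b, σ.2 (e a) < σ.2 (e b) ↔ π.2 a < π.2 b := by
  have hc : (Finset.univ.image e).card = π.1 := by
    rw [Finset.card_image_of_injective _ he.injective, Finset.card_univ, Fintype.card_fin]
  have hu : e = (Finset.univ.image e).orderEmbOfFin hc :=
    Finset.orderEmbOfFin_unique hc (fun x => Finset.mem_image_of_mem e (Finset.mem_univ x)) he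
  unfold IsOccurrence
  constructor
  · rintro ⟨h, H⟩ a b
    have := H a b
    rwa [← hu] at this
  · intro H
    refine ⟨hc, fun a b => ?_⟩
    rw [← hu]
    exact H a b

theorem image_orderEmbOfFin {n k : ℕ} (K : Finset (Fin n)) (h : K.card = k) :
    Finset.univ.image (K.orderEmbOfFin h) = K := by
  apply Finset.coe_injective
  rw [Finset.coe_image, Finset.coe_univ, Set.image_univ, Finset.range_orderEmbOfFin]

theorem strictMono_eq_of_image_eq {n k : ℕ} {e e' : Fin k → Fin n} (he : StrictMono e)
    (he' : StrictMono e') (h : Finset.univ.image e = Finset.univ.image e') : e = e' := by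
  apply StrictMono.range_inj he he' |>.1
  have := congrArg (fun s : Finset (Fin n) => (s : Set (Fin n))) h
  simpa using this

theorem occAt_eq {w : ℝ} (hw : 0 ≤ w) (π σ : Permutation) :
    occAt w π σ = (occMaps w π σ).ncard := by
  unfold occAt
  symm
  refine Set.ncard_congr (fun e _ => Finset.univ.image e) ?_ ?_ ?_
  · rintro e ⟨h1, h2, h3⟩
    exact ⟨(isOccurrence_image_iff h1).2 h2, (width_le_iff hw e).2 h3⟩
  · rintro e e' ⟨h1, -, -⟩ ⟨h1', -, -⟩ h
    exact strictMono_eq_of_image_eq h1 h1' h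
  · rintro K ⟨hK, hKw⟩
    obtain ⟨h, H⟩ := hK
    refine ⟨K.orderEmbOfFin h, ⟨(K.orderEmbOfFin h).strictMono, H, ?_⟩, image_orderEmbOfFin K h⟩
    rw [← width_le_iff hw, image_orderEmbOfFin]
    exact hKw

/-- The increasing maps of width at most `w`. -/
def increasingMaps (w : ℝ) (n k : ℕ) : Set (Fin k → Fin n) :=
  {e | StrictMono e ∧ ∀ a b, ((e b : ℕ) : ℝ) + 1 ≤ (e a : ℕ) + w}

theorem chooseAt_eq {w : ℝ} (hw : 0 ≤ w) (n k : ℕ) :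
    chooseAt w n k = (increasingMaps w n k).ncard := by
  unfold chooseAt
  symm
  refine Set.ncard_congr (fun e _ => Finset.univ.image e) ?_ ?_ ?_
  · rintro e ⟨h1, h3⟩
    refine ⟨?_, (width_le_iff hw e).2 h3⟩
    rw [Finset.card_image_of_injective _ h1.injective, Finset.card_univ, Fintype.card_fin]
  · rintro e e' ⟨h1, -⟩ ⟨h1', -⟩ h
    exact strictMono_eq_of_image_eq h1 h1' h
  · rintro K ⟨h, hKw⟩
    refine ⟨K.orderEmbOfFin h, ⟨(K.orderEmbOfFin h).strictMono, ?_⟩, image_orderEmbOfFin K h⟩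
    rw [← width_le_iff hw, image_orderEmbOfFin]
    exact hKw

/-- The map `π' ∘ π⁻¹` is strictly increasing and onto, hence the identity. -/
theorem perm_eq_of_lt_iff {k : ℕ} {π π' : Equiv.Perm (Fin k)}
    (h : ∀ a b, π a < π b ↔ π' a < π' b) : π = π' := by
  have hm : StrictMono (fun i => π' (π.symm i)) := by
    intro i j hij
    rw [← h]
    simpa using hij
  have hid : (fun i => π' (π.symm i)) = id := by
    apply StrictMono.range_inj hm strictMono_id |>.1
    rw [Set.range_id]
    exact (π.symm.trans π').surjective.range_eq
  ext i
  have := congrFun hid (π i)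
  simp only [Equiv.symm_apply_apply, id] at this
  rw [this]

/-- Every strict total order on `Fin k` is induced by a permutation. -/
theorem exists_pattern {k : ℕ} (r : Fin k → Fin k → Prop) (hi : ∀ a, ¬ r a a)
    (ht : ∀ a b c, r a b → r b c → r a c) (hc : ∀ a b, a ≠ b → r a b ∨ r b a) :
    ∃ π : Equiv.Perm (Fin k), ∀ a b, r a b ↔ π a < π b := by
  classical
  have hlt : ∀ a, (Finset.univ.filter (fun c => r c a)).card < k := by
    intro a
    have : Finset.univ.filter (fun c => r c a) ⊂ Finset.univ :=
      Finset.filter_ssubset.2 ⟨a, Finset.mem_univ _, hi a⟩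
    simpa using Finset.card_lt_card this
  -- The pattern sends each element to its rank, the number of elements below it.
  let p : Fin k → Fin k := fun a => ⟨_, hlt a⟩
  have hmono : ∀ a b, r a b → p a < p b := by
    intro a b hab
    change (Finset.univ.filter (fun c => r c a)).card < (Finset.univ.filter (fun c => r c b)).card
    apply Finset.card_lt_card
    rw [Finset.ssubset_iff_of_subset]
    · exact ⟨a, by simpa using hab, by simpa using hi a⟩
    · intro c
      simp only [Finset.mem_filter, Finset.mem_univ, true_and]
      exact fun h => ht _ _ _ h hab
  have hiff : ∀ a b, r a b ↔ p a < p b := by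
    intro a b
    refine ⟨hmono a b, fun h => ?_⟩
    by_cases hab : a = b
    · subst hab; exact absurd h (lt_irrefl _)
    · rcases hc a b hab with h' | h'
      · exact h'
      · exact absurd (h.trans (hmono _ _ h')) (lt_irrefl _)
  have hinj : Function.Injective p := by
    intro a b hab
    by_contra hne
    rcases hc a b hne with h' | h'
    · exact absurd (hmono _ _ h') (by rw [hab]; exact lt_irrefl _)
    · exact absurd (hmono _ _ h') (by rw [hab]; exact lt_irrefl _)
  exact ⟨Equiv.ofBijective p (Finite.injective_iff_bijective.1 hinj), hiff⟩

/-- Every increasing map of width at most `w` induces exactly one pattern, so the sets of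
occurrences partition these maps. -/
theorem sum_occAt {w : ℝ} (hw : 0 ≤ w) (σ : Permutation) (k : ℕ) :
    ∑ π : Equiv.Perm (Fin k), occAt w ⟨k, π⟩ σ = chooseAt w σ.1 k := by
  classical
  rw [chooseAt_eq hw]
  have h1 : ∀ π : Equiv.Perm (Fin k), occAt w ⟨k, π⟩ σ =
      ((increasingMaps w σ.1 k).toFinite.toFinset.filter
        (fun e => ∀ a b, σ.2 (e a) < σ.2 (e b) ↔ π a < π b)).card := by
    intro π
    rw [occAt_eq hw, Set.ncard_eq_toFinset_card _ (Set.toFinite _)]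
    congr 1
    ext e
    simp only [occMaps, increasingMaps, Set.Finite.mem_toFinset, Set.mem_ofPred_eq,
      Finset.mem_filter]
    tauto
  rw [Set.ncard_eq_toFinset_card _ (Set.toFinite _), Finset.sum_congr rfl (fun π _ => h1 π),
    ← Finset.card_biUnion]
  · congr 1
    ext e
    simp only [Finset.mem_biUnion, Finset.mem_univ, true_and, Finset.mem_filter]
    constructor
    · rintro ⟨_, h, -⟩
      exact h
    · intro h
      have he : StrictMono e := (by simpa [increasingMaps] using h : _ ∧ _).1
      obtain ⟨π, hπ⟩ := exists_pattern (fun a b => σ.2 (e a) < σ.2 (e b)) (fun _ => lt_irrefl _)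
        (fun _ _ _ => lt_trans)
        (fun a b hab => lt_or_gt_of_ne (fun h => hab (he.injective (σ.2.injective h))))
      exact ⟨π, h, hπ⟩
  · intro π _ π' _ hne
    rw [Function.onFun, Finset.disjoint_left]
    intro e he he'
    exact hne (perm_eq_of_lt_iff fun a b =>
      ((Finset.mem_filter.1 he).2 a b).symm.trans ((Finset.mem_filter.1 he').2 a b))

/-! ### Counting sets of bounded width -/

/-- Move a set `s` of numbers to the right of `i`, and add `i` to it. -/
def shiftInsert (p : ℕ × Finset ℕ) : Finset ℕ := insert p.1 (p.2.image (fun x => p.1 + 1 + x))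

theorem card_shiftInsert (i : ℕ) (s : Finset ℕ) : (shiftInsert (i, s)).card = s.card + 1 := by
  unfold shiftInsert
  rw [Finset.card_insert_of_notMem, Finset.card_image_of_injective _ (add_right_injective _)]
  simp only [Finset.mem_image, not_exists, not_and]
  intro x _
  omega

theorem shiftInsert_injective : Function.Injective shiftInsert := by
  rintro ⟨i, s⟩ ⟨j, t⟩ h
  have hmem : ∀ x, x ∈ shiftInsert (i, s) ↔ x ∈ shiftInsert (j, t) := fun x => by rw [h]
  simp only [shiftInsert, Finset.mem_insert, Finset.mem_image] at hmem
  have hij : i = j := by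
    have h1 := (hmem i).1 (Or.inl rfl)
    have h2 := (hmem j).2 (Or.inl rfl)
    rcases h1 with h1 | ⟨x, -, hx⟩
    · exact h1
    · rcases h2 with h2 | ⟨y, -, hy⟩
      · exact h2.symm
      · omega
  subst hij
  congr 1
  ext x
  have := hmem (i + 1 + x)
  constructor
  · intro hx
    rcases this.1 (Or.inr ⟨x, hx, rfl⟩) with h | ⟨y, hy, hxy⟩
    · omega
    · rwa [show x = y by omega]
  · intro hx
    rcases this.2 (Or.inr ⟨x, hx, rfl⟩) with h | ⟨y, hy, hxy⟩
    · omega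
    · rwa [show x = y by omega]

theorem width_le_nat_iff {n : ℕ} (w : ℕ) (K : Finset (Fin n)) :
    width K ≤ w ↔ ∀ x ∈ K, ∀ y ∈ K, (y : ℕ) + 1 ≤ x + w := by
  have h := width_le_iff (w := (w : ℝ)) (Nat.cast_nonneg w) (K.orderEmbOfFin rfl)
  rw [image_orderEmbOfFin, Nat.cast_le] at h
  rw [h]
  have hr := Finset.range_orderEmbOfFin K rfl
  constructor
  · intro H x hx y hy
    rw [← Finset.mem_coe, ← hr] at hx hy
    obtain ⟨a, rfl⟩ := hx
    obtain ⟨b, rfl⟩ := hy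
    exact_mod_cast H a b
  · intro H a b
    exact_mod_cast H _ (Finset.orderEmbOfFin_mem K rfl a) _ (Finset.orderEmbOfFin_mem K rfl b)

/-- A set is determined by its least element and the offsets of the others beyond it; width at most
`⌊f⌋₊` puts these `m` offsets into a range of size `⌊f⌋₊ - 1`. -/
theorem chooseAt_le_choose {f : ℝ} (hf : 0 ≤ f) (n m : ℕ) :
    chooseAt f n (m + 1) ≤ n * (⌊f⌋₊ - 1).choose m := by
  classical
  unfold chooseAt
  have : (n * (⌊f⌋₊ - 1).choose m) =
      ((Finset.range n ×ˢ Finset.powersetCard m (Finset.range (⌊f⌋₊ - 1))) : Finset _).card := by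
    rw [Finset.card_product, Finset.card_powersetCard, Finset.card_range, Finset.card_range]
  rw [this]
  refine le_trans ?_ (Finset.card_image_le (f := shiftInsert))
  rw [← Set.ncard_coe_finset]
  refine Set.ncard_le_ncard_of_injOn (fun K => K.map Fin.valEmbedding) ?_
    (fun K _ K' _ h => Finset.map_injective _ h) (Finset.finite_toSet _)
  rintro K ⟨hK, hw⟩
  rw [← Nat.le_floor_iff hf, width_le_nat_iff] at hw
  have hne : K.Nonempty := Finset.card_pos.1 (by omega)
  have hm := Finset.min'_mem K hne
  set i := K.min' hne with hi
  have hlt : ∀ x ∈ K.erase i, i < x := by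
    intro x hx
    rw [Finset.mem_erase] at hx
    exact lt_of_le_of_ne (Finset.min'_le _ _ hx.2) (Ne.symm hx.1)
  have hlt' : ∀ x ∈ K.erase i, (i : ℕ) < x := hlt
  rw [Finset.mem_coe, Finset.mem_image]
  refine ⟨((i : ℕ), (K.erase i).image (fun x : Fin n => (x : ℕ) - i - 1)), ?_, ?_⟩
  · rw [Finset.mem_product]
    refine ⟨by simp, ?_⟩
    rw [Finset.mem_powersetCard]
    constructor
    · intro y hy
      rw [Finset.mem_image] at hy
      obtain ⟨x, hx, rfl⟩ := hy
      have h1 := hw i hm x (Finset.mem_of_mem_erase hx)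
      have h2 := hlt' x hx
      rw [Finset.mem_range]
      omega
    · rw [Finset.card_image_of_injOn, Finset.card_erase_of_mem hm, hK]
      · rfl
      · intro x hx y hy h
        have h1 := hlt' x hx
        have h2 := hlt' y hy
        simp only at h
        apply Fin.ext
        omega
  · ext x
    simp only [shiftInsert, Finset.mem_insert, Finset.mem_image, Finset.mem_map,
      Fin.valEmbedding_apply]
    constructor
    · rintro (rfl | ⟨_, ⟨y, hy, rfl⟩, rfl⟩)
      · exact ⟨i, hm, rfl⟩
      · exact ⟨y, Finset.mem_of_mem_erase hy, by have := hlt' y hy; omega⟩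
    · rintro ⟨y, hy, rfl⟩
      by_cases hyi : y = i
      · left; rw [hyi]
      · right
        have hy' : y ∈ K.erase i := Finset.mem_erase.2 ⟨hyi, hy⟩
        exact ⟨_, ⟨y, hy', rfl⟩, by have := hlt' y hy'; omega⟩

/-- When the least element is below `n + 1 - ⌊f⌋₊`, every choice of offsets stays below `n`, and
distinct codes give distinct sets. -/
theorem choose_le_chooseAt {f : ℝ} (hf : 0 ≤ f) (n m : ℕ) (hf1 : 1 ≤ ⌊f⌋₊) :
    (n + 1 - ⌊f⌋₊) * (⌊f⌋₊ - 1).choose m ≤ chooseAt f n (m + 1) := by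
  classical
  unfold chooseAt
  have : ((n + 1 - ⌊f⌋₊) * (⌊f⌋₊ - 1).choose m) = ((Finset.range (n + 1 - ⌊f⌋₊) ×ˢ
      Finset.powersetCard m (Finset.range (⌊f⌋₊ - 1))) : Finset _).card := by
    rw [Finset.card_product, Finset.card_powersetCard, Finset.card_range, Finset.card_range]
  rw [this, ← Finset.card_image_of_injective _ shiftInsert_injective, ← Set.ncard_coe_finset,
    ← Set.ncard_image_of_injective _ (Finset.map_injective Fin.valEmbedding)]
  refine Set.ncard_le_ncard ?_ (Set.toFinite _)
  rintro K hK
  rw [Finset.mem_coe, Finset.mem_image] at hK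
  obtain ⟨⟨i, s⟩, h, rfl⟩ := hK
  rw [Finset.mem_product, Finset.mem_powersetCard, Finset.mem_range] at h
  obtain ⟨h1, h2, h3⟩ := h
  have hs : ∀ x ∈ s, x + 1 < ⌊f⌋₊ := fun x hx => by
    have := Finset.mem_range.1 (h2 hx); omega
  have hmem : ∀ x ∈ shiftInsert (i, s), i ≤ x ∧ x + 1 ≤ i + ⌊f⌋₊ := by
    intro x hx
    simp only [shiftInsert, Finset.mem_insert, Finset.mem_image] at hx
    rcases hx with rfl | ⟨y, hy, rfl⟩
    · omega
    · have := hs y hy; omega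
  simp only at h1
  have hn : ∀ x ∈ shiftInsert (i, s), x < n := fun x hx => by
    have := hmem x hx; omega
  refine ⟨(shiftInsert (i, s)).attachFin hn, ⟨?_, ?_⟩, ?_⟩
  · rw [Finset.card_attachFin, card_shiftInsert, h3]
  · rw [← Nat.le_floor_iff hf, width_le_nat_iff]
    intro x hx y hy
    rw [Finset.mem_attachFin] at hx hy
    have := hmem _ hx
    have := hmem _ hy
    omega
  · exact Finset.map_valEmbedding_attachFin hn

theorem chooseAt_le {f : ℝ} (hf : 0 ≤ f) (n m : ℕ) :
    (chooseAt f n (m + 1) : ℝ) ≤ n * (f ^ m / m.factorial) := by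
  calc (chooseAt f n (m + 1) : ℝ) ≤ (n * (⌊f⌋₊ - 1).choose m : ℕ) := by
        exact_mod_cast chooseAt_le_choose hf n m
    _ = n * ((⌊f⌋₊ - 1).choose m : ℝ) := by push_cast; ring
    _ ≤ n * (((⌊f⌋₊ - 1 : ℕ) : ℝ) ^ m / m.factorial) := by
        gcongr
        exact Nat.choose_le_pow_div m _
    _ ≤ n * (f ^ m / m.factorial) := by
        gcongr
        exact le_trans (Nat.cast_le.2 (Nat.sub_le _ _)) (Nat.floor_le hf)

theorem occAt_le_chooseAt (f : ℝ) (π σ : Permutation) : occAt f π σ ≤ chooseAt f σ.1 π.1 :=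
  Set.ncard_le_ncard (fun _ h => ⟨h.1.1, h.2⟩) (Set.toFinite _)

theorem occAt_floor {f : ℝ} (hf : 0 ≤ f) (π σ : Permutation) :
    occAt (⌊f⌋₊ : ℝ) π σ = occAt f π σ := by
  simp only [occAt, Nat.cast_le, Nat.le_floor_iff hf]

theorem occAt_eq_occ {f : ℝ} {σ : Permutation} (hf : (σ.1 : ℝ) ≤ f) (π : Permutation) :
    occAt f π σ = occ π σ := by
  unfold occAt occ
  congr 1
  ext K
  simp only [Set.mem_ofPred_eq, and_iff_left_iff_imp]
  intro _
  refine le_trans ?_ hf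
  rw [Nat.cast_le, width_le_nat_iff]
  intro x _ y _
  have := y.2
  omega

/-! ### Inflations, paddings, grids and direct sums -/

theorem finProdFinEquiv_lt_of_fst {m n : ℕ} {x y : Fin m × Fin n} (h : x.1 < y.1) :
    finProdFinEquiv x < finProdFinEquiv y := by
  rw [Fin.lt_def, finProdFinEquiv_apply_val, finProdFinEquiv_apply_val]
  have h1 : (x.1 : ℕ) + 1 ≤ y.1 := h
  have h2 := Nat.mul_le_mul_left n h1
  have := x.2.2
  rw [mul_add, mul_one] at h2
  omega

theorem finProdFinEquiv_lt_iff_snd {m n : ℕ} {c : Fin m} {x y : Fin n} :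
    finProdFinEquiv (c, x) < finProdFinEquiv (c, y) ↔ x < y := by
  rw [Fin.lt_def, finProdFinEquiv_apply_val, finProdFinEquiv_apply_val, Fin.lt_def]
  simp

theorem finProdFinEquiv_lt_iff_fst {m n : ℕ} {x y : Fin m × Fin n} (h : x.1 ≠ y.1) :
    finProdFinEquiv x < finProdFinEquiv y ↔ x.1 < y.1 := by
  refine ⟨fun H => ?_, finProdFinEquiv_lt_of_fst⟩
  rcases lt_or_gt_of_ne h with h' | h'
  · exact h'
  · exact absurd (H.trans (finProdFinEquiv_lt_of_fst h')) (lt_irrefl _)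

/-- Occurrences inside disjoint intervals of indices add up. -/
theorem sum_occAt_le {N q M : ℕ} (σ : Equiv.Perm (Fin N)) (A : Fin q → Equiv.Perm (Fin M))
    (φ : Fin q → Fin M → Fin N) (hφ : ∀ c i, (φ c i : ℕ) = M * c + i)
    (hA : ∀ c i j, σ (φ c i) < σ (φ c j) ↔ A c i < A c j) {w : ℝ} (hw : 0 ≤ w)
    {π : Permutation} (hπ : 1 ≤ π.1) :
    ∑ c, occAt w π ⟨M, A c⟩ ≤ occAt w π ⟨N, σ⟩ := by
  classical
  simp only [occAt_eq hw]
  simp only [Set.ncard_eq_toFinset_card _ (Set.toFinite (occMaps w π _))]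
  rw [← Finset.card_sigma]
  refine Finset.card_le_card_of_injOn (fun x a => φ x.1 (x.2 a)) ?_ ?_
  · rintro ⟨c, e⟩ h
    simp only [Finset.coe_sigma, Set.mem_sigma_iff, Finset.mem_coe, Set.Finite.mem_toFinset] at h
    obtain ⟨-, h1, h2, h3⟩ := h
    rw [Finset.mem_coe, Set.Finite.mem_toFinset]
    refine ⟨fun a b hab => ?_, fun a b => ?_, fun a b => ?_⟩
    · have h4 : (e a : ℕ) < e b := h1 hab
      have h5 := hφ c (e a)
      have h6 := hφ c (e b)
      exact Fin.lt_def.2 (by dsimp only; omega)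
    · exact (hA c _ _).trans (h2 a b)
    · have h4 := h3 a b
      have h5 : ((φ c (e a) : ℕ) : ℝ) = M * c + e a := by rw [hφ]; push_cast; ring
      have h6 : ((φ c (e b) : ℕ) : ℝ) = M * c + e b := by rw [hφ]; push_cast; ring
      dsimp only
      rw [h5, h6]
      linarith
  · rintro ⟨c, e⟩ _ ⟨c', e'⟩ _ h
    have key : ∀ a, M * (c : ℕ) + e a = M * c' + e' a := fun a => by
      rw [← hφ, ← hφ]
      exact congrArg Fin.val (congrFun h a)
    -- The block is recovered from one point by division by `M`. This needs a nonempty pattern: the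
    -- empty one would be counted once per block.
    have hc : c = c' := by
      have := key ⟨0, hπ⟩
      have h1 := (e ⟨0, hπ⟩).2
      have h2 := (e' ⟨0, hπ⟩).2
      have hM : 0 < M := by omega
      have e1 : (M * (c : ℕ) + e ⟨0, hπ⟩) / M = c := by
        rw [Nat.mul_add_div hM, Nat.div_eq_of_lt h1, add_zero]
      have e2 : (M * (c' : ℕ) + e' ⟨0, hπ⟩) / M = c' := by
        rw [Nat.mul_add_div hM, Nat.div_eq_of_lt h2, add_zero]
      apply Fin.ext
      rw [← e1, ← e2, this]
    subst hc
    congr 1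
    funext a
    have := key a
    apply Fin.ext
    omega

/-- The inflation of every point of `S` by a copy of `D`. -/
def inflatePerm {m n : ℕ} (S : Equiv.Perm (Fin m)) (D : Equiv.Perm (Fin n)) :
    Equiv.Perm (Fin (m * n)) :=
  finProdFinEquiv.symm.trans ((Equiv.prodCongr S D).trans finProdFinEquiv)

theorem inflatePerm_apply {m n : ℕ} (S : Equiv.Perm (Fin m)) (D : Equiv.Perm (Fin n))
    (x : Fin m × Fin n) :
    inflatePerm S D (finProdFinEquiv x) = finProdFinEquiv (S x.1, D x.2) := by
  simp [inflatePerm, Prod.map]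

/-- The inflation of every point of `S` by a copy of `D`. -/
def inflate (S D : Permutation) : Permutation := ⟨S.1 * D.1, inflatePerm S.2 D.2⟩

theorem mul_occAt_le_inflate (S D : Permutation) {w : ℝ} (hw : 0 ≤ w) {π : Permutation}
    (hπ : 1 ≤ π.1) : S.1 * occAt w π D ≤ occAt w π (inflate S D) := by
  have := sum_occAt_le (inflatePerm S.2 D.2) (fun _ => D.2)
    (fun c i => finProdFinEquiv (c, i))
    (fun c i => by rw [finProdFinEquiv_apply_val]; exact add_comm _ _)
    (fun c i j => by
      rw [inflatePerm_apply, inflatePerm_apply]; exact finProdFinEquiv_lt_iff_snd) hw hπ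
  simp only [Finset.sum_const, Finset.card_univ, Fintype.card_fin, smul_eq_mul] at this
  exact this

/-- Given an occurrence in `S`, a point may be chosen freely in each of the corresponding blocks.
The blocks are distinct, so `S` alone decides the relative order, and a span of at most `v` blocks
has width at most `v * |D|`. -/
theorem pow_mul_occAt_le_inflate (S D : Permutation) {v w : ℝ} (hv : 0 ≤ v)
    (hvw : v * D.1 ≤ w) (π : Permutation) :
    D.1 ^ π.1 * occAt v π S ≤ occAt w π (inflate S D) := by
  classical
  unfold inflate
  have hw : 0 ≤ w := le_trans (by positivity) hvw
  rw [occAt_eq hw, occAt_eq hv, Set.ncard_eq_toFinset_card _ (Set.toFinite _),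
    Set.ncard_eq_toFinset_card _ (Set.toFinite _)]
  have hc : D.1 ^ π.1 = (Finset.univ : Finset (Fin π.1 → Fin D.1)).card := by simp
  rw [hc, ← Finset.card_product]
  refine Finset.card_le_card_of_injOn (fun x a => finProdFinEquiv (x.2 a, x.1 a)) ?_ ?_
  · rintro ⟨g, e⟩ h
    simp only [Finset.coe_product, Set.mem_prod, Finset.mem_coe, Set.Finite.mem_toFinset] at h
    obtain ⟨-, h1, h2, h3⟩ := h
    rw [Finset.mem_coe, Set.Finite.mem_toFinset]
    refine ⟨fun a b hab => finProdFinEquiv_lt_of_fst (h1 hab), fun a b => ?_, fun a b => ?_⟩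
    · by_cases hab : a = b
      · subst hab
        exact iff_of_false (lt_irrefl _) (lt_irrefl _)
      · have h4 := inflatePerm_apply S.2 D.2 (e a, g a)
        have h5 := inflatePerm_apply S.2 D.2 (e b, g b)
        have h6 : inflatePerm S.2 D.2 (finProdFinEquiv (e a, g a)) <
            inflatePerm S.2 D.2 (finProdFinEquiv (e b, g b)) ↔ S.2 (e a) < S.2 (e b) := by
          rw [h4, h5]
          exact finProdFinEquiv_lt_iff_fst fun h => hab (h1.injective (S.2.injective h))
        exact h6.trans (h2 a b)
    · have h4 := h3 a b
      dsimp only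
      rw [finProdFinEquiv_apply_val, finProdFinEquiv_apply_val]
      have h5 : ((g b : ℕ) : ℝ) + 1 ≤ D.1 := by exact_mod_cast (g b).2
      have h6 : (0 : ℝ) ≤ D.1 := Nat.cast_nonneg _
      have h7 : (0 : ℝ) ≤ (g a : ℕ) := Nat.cast_nonneg _
      push_cast
      have h8 := mul_le_mul_of_nonneg_left h4 h6
      nlinarith
  · rintro ⟨g, e⟩ _ ⟨g', e'⟩ _ h
    have key : ∀ a, (e a, g a) = (e' a, g' a) := fun a =>
      finProdFinEquiv.injective (congrFun h a)
    simp only [Prod.mk.injEq] at key ⊢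
    exact ⟨funext fun a => (key a).2, funext fun a => (key a).1⟩

/-- As many copies of `P` as fit into length `u`, followed by an increasing sequence. -/
def padPerm {p : ℕ} (P : Equiv.Perm (Fin p)) (u : ℕ) : Equiv.Perm (Fin (u / p * p + u % p)) :=
  finSumFinEquiv.symm.trans
    ((Equiv.sumCongr (inflatePerm (Equiv.refl (Fin (u / p))) P) (Equiv.refl _)).trans
      finSumFinEquiv)

theorem padPerm_apply {p : ℕ} (P : Equiv.Perm (Fin p)) (u : ℕ) (c : Fin (u / p)) (i : Fin p) :
    padPerm P u (Fin.castAdd (u % p) (finProdFinEquiv (c, i))) =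
      Fin.castAdd (u % p) (finProdFinEquiv (c, P i)) := by
  simp [padPerm, inflatePerm_apply]

/-- As many copies of `P` as fit into length `u`, followed by an increasing sequence. -/
def padTo (P : Permutation) (u : ℕ) : Permutation := ⟨u / P.1 * P.1 + u % P.1, padPerm P.2 u⟩

theorem padTo_fst (P : Permutation) (u : ℕ) : (padTo P u).1 = u := Nat.div_add_mod' u P.1

theorem inverse_padTo (P : Permutation) (u : ℕ) : (padTo P u).inverse = padTo P.inverse u := rfl

theorem mul_occAt_le_padTo (P : Permutation) (u : ℕ) {w : ℝ} (hw : 0 ≤ w) {π : Permutation}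
    (hπ : 1 ≤ π.1) : (u / P.1) * occAt w π P ≤ occAt w π (padTo P u) := by
  have := sum_occAt_le (padPerm P.2 u) (fun _ => P.2)
    (fun c i => Fin.castAdd (u % P.1) (finProdFinEquiv (c, i)))
    (fun c i => by rw [Fin.val_castAdd, finProdFinEquiv_apply_val]; exact add_comm _ _)
    (fun c i j => by
      rw [padPerm_apply, padPerm_apply, Fin.lt_def, Fin.val_castAdd, Fin.val_castAdd, ← Fin.lt_def]
      exact finProdFinEquiv_lt_iff_snd) hw hπ
  simp only [Finset.sum_const, Finset.card_univ, Fintype.card_fin, smul_eq_mul] at this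
  exact this

/-- A permutation in which `A` occurs on consecutive intervals of indices and `B` occurs on
consecutive intervals of values. -/
def gridPerm {a b : ℕ} (A : Equiv.Perm (Fin a)) (B : Equiv.Perm (Fin b)) :
    Equiv.Perm (Fin (b * a)) :=
  finProdFinEquiv.symm.trans ((Equiv.prodComm _ _).trans
    ((Equiv.prodCongr A B.symm).trans (finProdFinEquiv.trans (finCongr (mul_comm _ _)))))

theorem gridPerm_apply {a b : ℕ} (A : Equiv.Perm (Fin a)) (B : Equiv.Perm (Fin b))
    (c : Fin b) (i : Fin a) : gridPerm A B (finProdFinEquiv (c, i)) =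
      Fin.cast (mul_comm _ _) (finProdFinEquiv (A i, B.symm c)) := by
  simp [gridPerm]

/-- The inverse has the same form with `A` and `B` exchanged; this symmetry is why `B.symm` enters
the definition. -/
theorem gridPerm_symm_apply {a b : ℕ} (A : Equiv.Perm (Fin a)) (B : Equiv.Perm (Fin b))
    (c : Fin a) (i : Fin b) :
    (gridPerm A B).symm (Fin.cast (mul_comm _ _) (finProdFinEquiv (c, i))) =
      finProdFinEquiv (B i, A.symm c) := by
  rw [Equiv.symm_apply_eq, gridPerm_apply, Equiv.symm_apply_apply, Equiv.apply_symm_apply]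

/-- A permutation in which `A` occurs on consecutive intervals of indices and `B` occurs on
consecutive intervals of values. -/
def grid (A B : Permutation) : Permutation := ⟨B.1 * A.1, gridPerm A.2 B.2⟩

theorem finProdFinEquiv_perm_lt_iff {a b : ℕ} (A : Equiv.Perm (Fin a)) (c : Fin b) (i j : Fin a) :
    finProdFinEquiv (A i, c) < finProdFinEquiv (A j, c) ↔ A i < A j := by
  by_cases hij : i = j
  · subst hij
    exact iff_of_false (lt_irrefl _) (lt_irrefl _)
  · exact finProdFinEquiv_lt_iff_fst (fun h => hij (A.injective h))

theorem mul_occAt_le_grid (A B : Permutation) {w : ℝ} (hw : 0 ≤ w) {π : Permutation}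
    (hπ : 1 ≤ π.1) : B.1 * occAt w π A ≤ occAt w π (grid A B) := by
  have := sum_occAt_le (gridPerm A.2 B.2) (fun _ => A.2)
    (fun c i => finProdFinEquiv (c, i))
    (fun c i => by rw [finProdFinEquiv_apply_val]; exact add_comm _ _)
    (fun c i j => by
      rw [gridPerm_apply, gridPerm_apply, Fin.lt_def, Fin.val_cast, Fin.val_cast, ← Fin.lt_def]
      exact finProdFinEquiv_perm_lt_iff _ _ _ _) hw hπ
  simp only [Finset.sum_const, Finset.card_univ, Fintype.card_fin, smul_eq_mul] at this
  exact this

theorem mul_occAt_le_inverse_grid (A B : Permutation) {w : ℝ} (hw : 0 ≤ w) {π : Permutation}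
    (hπ : 1 ≤ π.1) : A.1 * occAt w π B ≤ occAt w π (grid A B).inverse := by
  have := sum_occAt_le (gridPerm A.2 B.2).symm (fun _ => B.2)
    (fun c i => Fin.cast (mul_comm _ _) (finProdFinEquiv (c, i)))
    (fun c i => by
      rw [Fin.val_cast, finProdFinEquiv_apply_val]; exact add_comm _ _)
    (fun c i j => by
      rw [gridPerm_symm_apply, gridPerm_symm_apply]
      exact finProdFinEquiv_perm_lt_iff _ _ _ _) hw hπ
  simp only [Finset.sum_const, Finset.card_univ, Fintype.card_fin, smul_eq_mul] at this
  exact this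

/-- The direct sum of permutations of the same length. -/
def directSumPerm {q M : ℕ} (A : Fin q → Equiv.Perm (Fin M)) : Equiv.Perm (Fin (q * M)) :=
  finProdFinEquiv.symm.trans ((Equiv.prodShear (Equiv.refl _) A).trans finProdFinEquiv)

theorem directSumPerm_apply {q M : ℕ} (A : Fin q → Equiv.Perm (Fin M)) (c : Fin q) (i : Fin M) :
    directSumPerm A (finProdFinEquiv (c, i)) = finProdFinEquiv (c, A c i) := by
  simp [directSumPerm]

theorem sum_occAt_le_directSumPerm {q M : ℕ} (A : Fin q → Equiv.Perm (Fin M)) {w : ℝ}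
    (hw : 0 ≤ w) {π : Permutation} (hπ : 1 ≤ π.1) :
    ∑ c, occAt w π ⟨M, A c⟩ ≤ occAt w π ⟨q * M, directSumPerm A⟩ := by
  refine sum_occAt_le (directSumPerm A) A (fun c i => finProdFinEquiv (c, i))
    (fun c i => by rw [finProdFinEquiv_apply_val]; exact add_comm _ _)
    (fun c i j => ?_) hw hπ
  rw [directSumPerm_apply, directSumPerm_apply]
  exact finProdFinEquiv_lt_iff_snd

/-- The local density is nearly unchanged when a permutation is padded and then used to inflate
another one. -/
theorem occAt_inflate_padTo_ge (S P : Permutation) {u : ℕ} {δ : ℝ} (hP : 0 < P.1) (hd : δ ≤ 1)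
    (hδ : (P.1 : ℝ) ≤ δ * u) {w : ℝ} (hw : 0 ≤ w) {π : Permutation} (hπ : 1 ≤ π.1) {x : ℝ}
    (hx : x * P.1 ≤ occAt w π P) :
    (1 - δ) * x * (S.1 * u) ≤ occAt w π (inflate S (padTo P u)) := by
  have h1 : S.1 * ((u / P.1) * occAt w π P) ≤ occAt w π (inflate S (padTo P u)) :=
    (Nat.mul_le_mul_left _ (mul_occAt_le_padTo P u hw hπ)).trans
      (mul_occAt_le_inflate S (padTo P u) hw hπ)
  have h1' : (S.1 : ℝ) * ((u / P.1 : ℕ) * occAt w π P) ≤ occAt w π (inflate S (padTo P u)) := by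
    exact_mod_cast h1
  refine le_trans ?_ h1'
  rw [show (1 - δ) * x * (S.1 * u) = S.1 * ((1 - δ) * u * x) by ring]
  refine mul_le_mul_of_nonneg_left ?_ (Nat.cast_nonneg _)
  have hP' : (0 : ℝ) < P.1 := by exact_mod_cast hP
  -- The full copies cover all but at most `|P| ≤ δ * u` of the length `u`.
  have h2 : ((u / P.1 : ℕ) : ℝ) * P.1 + P.1 ≥ u := by
    have := Nat.div_add_mod' u P.1
    have := Nat.mod_lt u hP
    exact_mod_cast (by omega : u ≤ u / P.1 * P.1 + P.1)
  have hq : (0 : ℝ) ≤ (u / P.1 : ℕ) := Nat.cast_nonneg _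
  have hu : (0 : ℝ) ≤ u := Nat.cast_nonneg _
  -- The value `x` will be a target density minus an error, so it may be negative; then there is
  -- nothing to prove.
  rcases le_or_gt 0 x with hx0 | hx0
  · calc (1 - δ) * u * x ≤ ((u / P.1 : ℕ) * P.1) * x := by
          refine mul_le_mul_of_nonneg_right ?_ hx0
          linarith
      _ = (u / P.1 : ℕ) * (x * P.1) := by ring
      _ ≤ _ := mul_le_mul_of_nonneg_left hx hq
  · refine le_trans (mul_nonpos_of_nonneg_of_nonpos ?_ hx0.le) (by positivity)
    exact mul_nonneg (by linarith) hu

/-! ### Approximate limits and their stability under the constructions -/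

/-- Up to an error `ε`, the density at scale `w` of every pattern of length at most `K` in `P` is
at least that prescribed by `Ξ`. -/
def ScaleGood (K : ℕ) (ε w : ℝ) (Ξ : Permutation → ℝ) (P : Permutation) : Prop :=
  ∀ π : Permutation, 1 ≤ π.1 → π.1 ≤ K →
    (Ξ π - ε) * (w ^ (π.1 - 1) / (π.1 - 1).factorial) * P.1 ≤ occAt w π P

/-- Up to an error `ε`, the local density of every pattern of length at most `K` in `P` is
at least that prescribed by `X`. -/
def LocalGood (K : ℕ) (ε : ℝ) (X : Permutation → ℝ) (P : Permutation) : Prop :=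
  ∀ π : Permutation, 1 ≤ π.1 → π.1 ≤ K → (X π - ε) * P.1 ≤ occAt π.1 π P

theorem occAt_mono {v w : ℝ} (h : v ≤ w) (π σ : Permutation) : occAt v π σ ≤ occAt w π σ :=
  Set.ncard_le_ncard (fun _ hK => ⟨hK.1, hK.2.trans h⟩) (Set.toFinite _)

/-- The normalisation is homogeneous, |D|^k · v^(k-1) · |S| = (v|D|)^(k-1) · |S||D|, so the error
does not grow. -/
theorem ScaleGood.inflate {K : ℕ} {ε v : ℝ} {Ξ : Permutation → ℝ} {S : Permutation} (hv : 0 ≤ v)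
    (h : ScaleGood K ε v Ξ S) (D : Permutation) :
    ScaleGood K ε (v * D.1) Ξ (inflate S D) := by
  intro π h1 h2
  have h3 := h π h1 h2
  have h4 : ((D.1 ^ π.1 * occAt v π S : ℕ) : ℝ) ≤ occAt (v * D.1) π (PermScale.inflate S D) :=
    Nat.cast_le.2 (pow_mul_occAt_le_inflate S D hv le_rfl π)
  refine le_trans ?_ h4
  push_cast
  refine le_trans (le_of_eq ?_) (mul_le_mul_of_nonneg_left h3 (by positivity))
  obtain ⟨m, hm⟩ : ∃ m, π.1 = m + 1 := ⟨π.1 - 1, by omega⟩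
  rw [hm]
  simp only [PermScale.inflate, Nat.add_sub_cancel]
  push_cast
  ring

theorem ScaleGood.grid {K : ℕ} {ε v : ℝ} {Ξ Ξ' : Permutation → ℝ} {A B : Permutation}
    (hv : 0 ≤ v) (hA : ScaleGood K ε v Ξ A) (hB : ScaleGood K ε v Ξ' B) :
    ScaleGood K ε v Ξ (grid A B) ∧ ScaleGood K ε v Ξ' (grid A B).inverse := by
  constructor
  · intro π h1 h2
    have h4 : ((B.1 * occAt v π A : ℕ) : ℝ) ≤ occAt v π (PermScale.grid A B) :=
      Nat.cast_le.2 (mul_occAt_le_grid A B hv h1)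
    refine le_trans ?_ h4
    push_cast
    refine le_trans (le_of_eq ?_) (mul_le_mul_of_nonneg_left (hA π h1 h2) (Nat.cast_nonneg _))
    simp only [PermScale.grid]
    push_cast
    ring
  · intro π h1 h2
    have h4 : ((A.1 * occAt v π B : ℕ) : ℝ) ≤ occAt v π (PermScale.grid A B).inverse :=
      Nat.cast_le.2 (mul_occAt_le_inverse_grid A B hv h1)
    refine le_trans ?_ h4
    push_cast
    refine le_trans (le_of_eq ?_) (mul_le_mul_of_nonneg_left (hB π h1 h2) (Nat.cast_nonneg _))
    simp only [PermScale.grid, Permutation.inverse]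
    push_cast
    ring

theorem LocalGood.grid {K : ℕ} {ε : ℝ} {X X' : Permutation → ℝ} {A B : Permutation}
    (hA : LocalGood K ε X A) (hB : LocalGood K ε X' B) :
    LocalGood K ε X (grid A B) ∧ LocalGood K ε X' (grid A B).inverse := by
  constructor
  · intro π h1 h2
    have h4 : ((B.1 * occAt π.1 π A : ℕ) : ℝ) ≤ occAt π.1 π (PermScale.grid A B) :=
      Nat.cast_le.2 (mul_occAt_le_grid A B (Nat.cast_nonneg _) h1)
    refine le_trans ?_ h4
    push_cast
    refine le_trans (le_of_eq ?_) (mul_le_mul_of_nonneg_left (hA π h1 h2) (Nat.cast_nonneg _))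
    simp only [PermScale.grid]
    push_cast
    ring
  · intro π h1 h2
    have h4 : ((A.1 * occAt π.1 π B : ℕ) : ℝ) ≤ occAt π.1 π (PermScale.grid A B).inverse :=
      Nat.cast_le.2 (mul_occAt_le_inverse_grid A B (Nat.cast_nonneg _) h1)
    refine le_trans ?_ h4
    push_cast
    refine le_trans (le_of_eq ?_) (mul_le_mul_of_nonneg_left (hB π h1 h2) (Nat.cast_nonneg _))
    simp only [PermScale.grid, Permutation.inverse]
    push_cast
    ring

theorem IsScalingFunction.tendsto_atTop {f : ℕ → ℝ} (hf : IsScalingFunction f) :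
    Tendsto f atTop atTop := by
  have h : Tendsto (fun n => 1 / f n) atTop (𝓝[>] 0) := by
    rw [tendsto_nhdsWithin_iff]
    refine ⟨hf.one_dominated, ?_⟩
    filter_upwards [eventually_ge_atTop 1] with n hn
    exact one_div_pos.2 (hf.pos n hn)
  refine h.inv_tendsto_nhdsGT_zero.congr fun n => ?_
  rw [Pi.inv_apply, one_div, inv_inv]

theorem finite_setOf_length_le (K : ℕ) : {π : Permutation | π.1 ≤ K}.Finite := by
  have : {π : Permutation | π.1 ≤ K} =
      ((Finset.range (K + 1)).sigma (fun n => (Finset.univ : Finset (Equiv.Perm (Fin n))))) := by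
    ext π
    simp
  rw [this]
  exact Finset.finite_toSet _

theorem densityAt_le_one (f : ℝ) (π σ : Permutation) : densityAt f π σ ≤ 1 :=
  div_le_one_of_le₀ (Nat.cast_le.2 (occAt_le_chooseAt f π σ)) (Nat.cast_nonneg _)

theorem densityAt_nonneg (f : ℝ) (π σ : Permutation) : 0 ≤ densityAt f π σ :=
  div_nonneg (Nat.cast_nonneg _) (Nat.cast_nonneg _)

theorem IsScaleLimit.le_one {Ξ : Permutation → ℝ} (h : IsScaleLimit Ξ) (π : Permutation) :
    Ξ π ≤ 1 := by
  obtain ⟨f, σ, -, hσ⟩ := h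
  exact le_of_tendsto (hσ.2 π) (Eventually.of_forall fun j => densityAt_le_one _ _ _)

/-- Both correction factors tend to 1 when 1 ≪ f ≪ n, so the upper bound `chooseAt_le` is
asymptotically sharp. -/
theorem chooseAt_ge {f : ℝ} {n m : ℕ} (hf : 1 ≤ f) (hm : m ≤ ⌊f⌋₊) (hn : ⌊f⌋₊ ≤ n) :
    (1 - (⌊f⌋₊ : ℝ) / n) * (1 - (m : ℝ) / ⌊f⌋₊) ^ m * (((⌊f⌋₊ : ℝ) ^ m / m.factorial) * n) ≤
      chooseAt f n (m + 1) := by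
  have hw : 1 ≤ ⌊f⌋₊ := (Nat.one_le_floor_iff f).2 hf
  have h1 : (((n + 1 - ⌊f⌋₊) * (⌊f⌋₊ - 1).choose m : ℕ) : ℝ) ≤ chooseAt f n (m + 1) :=
    Nat.cast_le.2 (choose_le_chooseAt (by linarith) n m hw)
  refine le_trans ?_ h1
  set w := ⌊f⌋₊ with hwdef
  have h2 : (w - m) ^ m ≤ (w - 1).choose m * m.factorial := by
    have := Nat.pow_sub_le_descFactorial (w - 1) m
    rw [Nat.sub_add_cancel hw, Nat.descFactorial_eq_factorial_mul_choose, mul_comm] at this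
    exact this
  have h3 : ((w : ℝ) - m) ^ m ≤ ((w - 1).choose m : ℝ) * m.factorial := by
    rw [← Nat.cast_sub hm]
    exact_mod_cast h2
  have h3' : ((w : ℝ) - m) ^ m / m.factorial ≤ ((w - 1).choose m : ℝ) := by
    rw [div_le_iff₀ (by positivity)]
    exact h3
  have hn0 : (0 : ℝ) < n := by exact_mod_cast (by omega : 0 < n)
  have hw0 : (0 : ℝ) < w := by exact_mod_cast (by omega : 0 < w)
  have h4 : (n : ℝ) - w ≤ ((n + 1 - w : ℕ) : ℝ) := by
    rw [Nat.cast_sub (by omega)]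
    push_cast
    linarith
  have hm' : (m : ℝ) ≤ w := Nat.cast_le.2 hm
  have hn' : (w : ℝ) ≤ n := Nat.cast_le.2 hn
  calc (1 - (w : ℝ) / n) * (1 - (m : ℝ) / w) ^ m * (((w : ℝ) ^ m / m.factorial) * n)
      = ((n : ℝ) - w) * (((w : ℝ) - m) ^ m / m.factorial) := by
        have e1 : ((w : ℝ) - m) ^ m = (1 - (m : ℝ) / w) ^ m * (w : ℝ) ^ m := by
          rw [← mul_pow]
          congr 1
          field_simp
        have e2 : (n : ℝ) - w = (1 - (w : ℝ) / n) * n := by field_simp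
        rw [e1, e2]
        ring
    _ ≤ ((n + 1 - w : ℕ) : ℝ) * ((w - 1).choose m : ℝ) := by
        refine mul_le_mul h4 h3' ?_ (Nat.cast_nonneg _)
        exact div_nonneg (pow_nonneg (by linarith) _) (by positivity)
    _ = _ := by push_cast; ring

/-- One sufficiently late term of a sequence converging to `Ξ` will do. Rounding the width down to
an integer `v` does not change the occurrences. -/
theorem IsScaleLimit.exists_scaleGood {Ξ : Permutation → ℝ} (h : IsScaleLimit Ξ) (K : ℕ) {ε : ℝ}
    (hε : 0 < ε) : ∃ v : ℕ, 1 ≤ v ∧ ∃ A : Permutation, 0 < A.1 ∧ ScaleGood K ε v Ξ A := by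
  obtain ⟨f, σ, hf, hl, hσ⟩ := h
  have hl : Tendsto (fun j => (σ j).1) atTop atTop := hl
  have hfl : Tendsto (fun j => f (σ j).1) atTop atTop := hf.tendsto_atTop.comp hl
  have hw : Tendsto (fun j => ⌊f (σ j).1⌋₊) atTop atTop := tendsto_nat_floor_atTop.comp hfl
  have hwn : Tendsto (fun j => (⌊f (σ j).1⌋₊ : ℝ) / (σ j).1) atTop (𝓝 0) := by
    refine squeeze_zero' (Eventually.of_forall fun j => by positivity) ?_
      (hf.dominated_id.comp hl)
    filter_upwards [hfl.eventually_ge_atTop 0] with j hj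
    exact div_le_div_of_nonneg_right (Nat.floor_le hj) (Nat.cast_nonneg _)
  have hmw : ∀ m : ℕ, Tendsto (fun j => (m : ℝ) / ⌊f (σ j).1⌋₊) atTop (𝓝 0) := fun m =>
    (tendsto_const_div_atTop_nhds_zero_nat (m : ℝ)).comp hw
  have hev : ∀ π ∈ {π : Permutation | π.1 ≤ K}, ∀ᶠ j in atTop,
      Ξ π - ε ≤ densityAt (f (σ j).1) π (σ j) *
        ((1 - (⌊f (σ j).1⌋₊ : ℝ) / (σ j).1) *
          (1 - ((π.1 - 1 : ℕ) : ℝ) / ⌊f (σ j).1⌋₊) ^ (π.1 - 1)) := by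
    intro π _
    have h1 : Tendsto (fun j => densityAt (f (σ j).1) π (σ j) *
        ((1 - (⌊f (σ j).1⌋₊ : ℝ) / (σ j).1) *
          (1 - ((π.1 - 1 : ℕ) : ℝ) / ⌊f (σ j).1⌋₊) ^ (π.1 - 1))) atTop
        (𝓝 (Ξ π * ((1 - 0) * (1 - 0) ^ (π.1 - 1)))) :=
      (hσ π).mul ((tendsto_const_nhds.sub hwn).mul ((tendsto_const_nhds.sub (hmw _)).pow _))
    simp only [sub_zero, one_pow, mul_one] at h1
    exact h1.eventually_const_le (by linarith)
  have hev' := (eventually_all_finite (finite_setOf_length_le K)).2 hev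
  have hle : ∀ᶠ j in atTop, f (σ j).1 ≤ (σ j).1 := by
    filter_upwards [hl.eventually_ge_atTop 1] with j hj
    exact hf.le_self _ hj
  obtain ⟨j, hj1, hj2, hj3, hj4, hj5⟩ := (hev'.and ((hfl.eventually_ge_atTop 1).and
    ((hw.eventually_ge_atTop K).and ((hl.eventually_ge_atTop 1).and hle)))).exists
  refine ⟨⌊f (σ j).1⌋₊, (Nat.one_le_floor_iff _).2 hj2, σ j, hj4, ?_⟩
  intro π h1 h2
  have hf0 : 0 ≤ f (σ j).1 := by linarith
  have h3 := hj1 π h2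
  obtain ⟨m, hm⟩ : ∃ m, π.1 = m + 1 := ⟨π.1 - 1, by omega⟩
  have hwle : ⌊f (σ j).1⌋₊ ≤ (σ j).1 := Nat.floor_le_of_le hj5
  have h4 := chooseAt_ge (n := (σ j).1) (m := m) hj2 (by omega) hwle
  rw [occAt_floor hf0]
  have h5 : densityAt (f (σ j).1) π (σ j) * chooseAt (f (σ j).1) (σ j).1 π.1 ≤
      occAt (f (σ j).1) π (σ j) := by
    unfold densityAt
    by_cases hz : (chooseAt (f (σ j).1) (σ j).1 π.1 : ℝ) = 0
    · rw [hz, mul_zero]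
      exact Nat.cast_nonneg _
    · rw [div_mul_cancel₀ _ hz]
  refine le_trans ?_ h5
  have hd := densityAt_nonneg (f (σ j).1) π (σ j)
  rw [show π.1 - 1 = m by omega] at h3 ⊢
  rw [hm]
  refine le_trans ?_ (mul_le_mul_of_nonneg_left h4 hd)
  rw [mul_assoc, ← mul_assoc (densityAt _ _ _)]
  exact mul_le_mul_of_nonneg_right h3 (by positivity)

/-- The identity permutation of length `n`. -/
def idPermutation (n : ℕ) : Permutation := ⟨n, Equiv.refl _⟩

/-- The permutations found for the two limits may be good at different scales `a` and `b`. Inflating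
the first by `b` points and the second by `a` points brings both to the scale `a * b`, where the
grid combines them. -/
theorem exists_scaleGood_both {Ξ Ξ' : Permutation → ℝ} (h : IsScaleLimit Ξ)
    (h' : IsScaleLimit Ξ') (K : ℕ) {ε : ℝ} (hε : 0 < ε) :
    ∃ v : ℕ, 1 ≤ v ∧ ∃ S : Permutation, 0 < S.1 ∧ ScaleGood K ε v Ξ S ∧
      ScaleGood K ε v Ξ' S.inverse := by
  obtain ⟨a, ha, A, hA0, hA⟩ := h.exists_scaleGood K hε
  obtain ⟨b, hb, B, hB0, hB⟩ := h'.exists_scaleGood K hε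
  refine ⟨a * b, Nat.mul_pos ha hb, grid (inflate A (idPermutation b))
    (inflate B (idPermutation a)), ?_, ?_⟩
  · exact Nat.mul_pos (Nat.mul_pos hB0 ha) (Nat.mul_pos hA0 hb)
  · push_cast
    refine ScaleGood.grid (by positivity) (hA.inflate (Nat.cast_nonneg _) (idPermutation b)) ?_
    rw [mul_comm (a : ℝ)]
    exact hB.inflate (Nat.cast_nonneg _) (idPermutation a)

theorem ScaleGood.mono {K : ℕ} {ε ε' w : ℝ} {Ξ : Permutation → ℝ} {P : Permutation} (hw : 0 ≤ w)
    (h : ScaleGood K ε w Ξ P) (hε : ε ≤ ε') : ScaleGood K ε' w Ξ P := by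
  intro π h1 h2
  refine le_trans ?_ (h π h1 h2)
  gcongr

theorem LocalGood.mono {K : ℕ} {ε ε' : ℝ} {X : Permutation → ℝ} {P : Permutation}
    (h : LocalGood K ε X P) (hε : ε ≤ ε') : LocalGood K ε' X P := by
  intro π h1 h2
  refine le_trans ?_ (h π h1 h2)
  gcongr

/-- Goodness at scale `v` implies goodness at slightly larger scales. -/
theorem ScaleGood.scale {K : ℕ} {ε v w : ℝ} {Ξ : Permutation → ℝ} {P : Permutation}
    (hv : 0 ≤ v) (hvw : v ≤ w) (hε : 0 ≤ ε) (hΞ : ∀ π, Ξ π ≤ 1)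
    (hpow : ∀ m ≤ K, (1 - ε) * w ^ m ≤ v ^ m) (h : ScaleGood K ε v Ξ P) :
    ScaleGood K (2 * ε) w Ξ P := by
  intro π h1 h2
  have hw : 0 ≤ w := hv.trans hvw
  have h3 : (occAt v π P : ℝ) ≤ occAt w π P := Nat.cast_le.2 (occAt_mono hvw π P)
  rcases le_or_gt (Ξ π - ε) 0 with h0 | h0
  · refine le_trans (mul_nonpos_of_nonpos_of_nonneg
      (mul_nonpos_of_nonpos_of_nonneg (by linarith) (by positivity)) (Nat.cast_nonneg _))
      (Nat.cast_nonneg _)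
  · refine le_trans ?_ ((h π h1 h2).trans h3)
    refine mul_le_mul_of_nonneg_right ?_ (Nat.cast_nonneg _)
    rw [← mul_div_assoc, ← mul_div_assoc]
    refine div_le_div_of_nonneg_right ?_ (Nat.cast_nonneg _)
    have hp := hpow (π.1 - 1) (by omega)
    have hw' : 0 ≤ w ^ (π.1 - 1) := by positivity
    -- This is (Ξ - ε)(1 - ε) ≥ Ξ - 2ε, valid because Ξ ≤ 1.
    calc (Ξ π - 2 * ε) * w ^ (π.1 - 1) ≤ (Ξ π - ε) * (1 - ε) * w ^ (π.1 - 1) := by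
          refine mul_le_mul_of_nonneg_right ?_ hw'
          nlinarith [hΞ π]
      _ = (Ξ π - ε) * ((1 - ε) * w ^ (π.1 - 1)) := by ring
      _ ≤ _ := mul_le_mul_of_nonneg_left hp h0.le

theorem inflate_padTo_fst (S P : Permutation) (u : ℕ) : (inflate S (padTo P u)).1 = S.1 * u := by
  change S.1 * (padTo P u).1 = _
  rw [padTo_fst]

/-- Occurrences inside single copies of `P` suffice: the copies fill at least a fraction 1 - δ of
the length, and (1 - δ)(Ξ - ε) ≥ Ξ - ε - δ. The outer permutation `S` plays no role and remains free
for the next scale. -/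
theorem ScaleGood.inflate_padTo {K : ℕ} {ε δ w : ℝ} {Ξ : Permutation → ℝ} {P : Permutation}
    (h : ScaleGood K ε w Ξ P) (hΞ : ∀ π, Ξ π ≤ 1) (hw : 0 ≤ w) (hε : 0 ≤ ε) (hδ0 : 0 ≤ δ)
    (hδ1 : δ ≤ 1) (hP : 0 < P.1) (S : Permutation) {u : ℕ} (hδ : (P.1 : ℝ) ≤ δ * u) :
    ScaleGood K (ε + δ) w Ξ (PermScale.inflate S (padTo P u)) := by
  intro π h1 h2
  refine le_trans ?_ (occAt_inflate_padTo_ge S P hP hδ1 hδ hw h1 (h π h1 h2))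
  rw [inflate_padTo_fst]
  push_cast
  refine mul_le_mul_of_nonneg_right ?_ (by positivity)
  rw [← mul_assoc]
  refine mul_le_mul_of_nonneg_right ?_ (by positivity)
  nlinarith [hΞ π]

theorem LocalGood.inflate_padTo {K : ℕ} {ε δ : ℝ} {X : Permutation → ℝ} {P : Permutation}
    (h : LocalGood K ε X P) (hX : ∀ π, X π ≤ 1) (hε : 0 ≤ ε) (hδ0 : 0 ≤ δ)
    (hδ1 : δ ≤ 1) (hP : 0 < P.1) (S : Permutation) {u : ℕ} (hδ : (P.1 : ℝ) ≤ δ * u) :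
    LocalGood K (ε + δ) X (inflate S (padTo P u)) := by
  intro π h1 h2
  refine le_trans ?_ (occAt_inflate_padTo_ge S P hP hδ1 hδ (Nat.cast_nonneg _) h1 (h π h1 h2))
  rw [inflate_padTo_fst]
  push_cast
  refine mul_le_mul_of_nonneg_right ?_ (by positivity)
  nlinarith [hX π]

/-- `P` nearly has the prescribed local limits and scale limits at the scales `w t`, both for
itself and for its inverse. -/
structure AllGood (F : Finset ℕ) (K : ℕ) (ε : ℝ) (w : ℕ → ℝ) (X X' : Permutation → ℝ)
    (Ξ Ξ' : ℕ → Permutation → ℝ) (P : Permutation) : Prop where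
  loc : LocalGood K ε X P
  locInv : LocalGood K ε X' P.inverse
  scale : ∀ t ∈ F, ScaleGood K ε (w t) (Ξ t) P
  scaleInv : ∀ t ∈ F, ScaleGood K ε (w t) (Ξ' t) P.inverse

theorem AllGood.inflate_padTo {F : Finset ℕ} {K : ℕ} {ε δ : ℝ} {w : ℕ → ℝ}
    {X X' : Permutation → ℝ} {Ξ Ξ' : ℕ → Permutation → ℝ} {P : Permutation}
    (h : AllGood F K ε w X X' Ξ Ξ' P) (hX : ∀ π, X π ≤ 1) (hX' : ∀ π, X' π ≤ 1)
    (hΞ : ∀ t π, Ξ t π ≤ 1) (hΞ' : ∀ t π, Ξ' t π ≤ 1) (hw : ∀ t, 0 ≤ w t) (hε : 0 ≤ ε)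
    (hδ0 : 0 ≤ δ) (hδ1 : δ ≤ 1) (hP : 0 < P.1) (S : Permutation) {u : ℕ}
    (hδ : (P.1 : ℝ) ≤ δ * u) :
    AllGood F K (ε + δ) w X X' Ξ Ξ' (inflate S (padTo P u)) where
  loc := h.loc.inflate_padTo hX hε hδ0 hδ1 hP S hδ
  locInv := h.locInv.inflate_padTo hX' hε hδ0 hδ1 hP S.inverse hδ
  scale t ht := (h.scale t ht).inflate_padTo (hΞ t) (hw t) hε hδ0 hδ1 hP S hδ
  scaleInv t ht := (h.scaleInv t ht).inflate_padTo (hΞ' t) (hw t) hε hδ0 hδ1 hP S.inverse hδ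

theorem AllGood.mono {F : Finset ℕ} {K : ℕ} {ε ε' : ℝ} {w : ℕ → ℝ}
    {X X' : Permutation → ℝ} {Ξ Ξ' : ℕ → Permutation → ℝ} {P : Permutation}
    (h : AllGood F K ε w X X' Ξ Ξ' P) (hw : ∀ t, 0 ≤ w t) (hε : ε ≤ ε') :
    AllGood F K ε' w X X' Ξ Ξ' P where
  loc := h.loc.mono hε
  locInv := h.locInv.mono hε
  scale t ht := (h.scale t ht).mono (hw t) hε
  scaleInv t ht := (h.scaleInv t ht).mono (hw t) hε

/-! ### Nesting finitely many scales -/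

theorem Dominated.trans {f g h : ℕ → ℝ} (hg : ∀ n, 1 ≤ n → 0 < g n) (h1 : Dominated f g)
    (h2 : Dominated g h) : Dominated f h := by
  have := Tendsto.mul h1 h2
  rw [mul_zero] at this
  refine this.congr' ?_
  filter_upwards [eventually_ge_atTop 1] with n hn
  have := (hg n hn).ne'
  rw [div_mul_div_cancel₀ this]

theorem exists_dominant {f : ℕ → ℕ → ℝ} (hf : ∀ t, IsScalingFunction (f t))
    (hdom : ∀ s t, s ≠ t → Dominated (f s) (f t) ∨ Dominated (f t) (f s)) (F : Finset ℕ)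
    (hF : F.Nonempty) : ∃ t ∈ F, ∀ s ∈ F, s ≠ t → Dominated (f s) (f t) := by
  classical
  induction hF using Finset.Nonempty.cons_induction with
  | singleton a => exact ⟨a, by simp, by simp⟩
  | cons a s ha _ ih =>
    obtain ⟨t, ht, h⟩ := ih
    have hat : a ≠ t := fun h => ha (h ▸ ht)
    rcases hdom a t hat with h1 | h1
    · refine ⟨t, Finset.mem_cons_of_mem ht, fun s hs hst => ?_⟩
      rcases Finset.mem_cons.1 hs with rfl | hs
      · exact h1
      · exact h s hs hst
    · refine ⟨a, Finset.mem_cons_self _ _, fun s hs hsa => ?_⟩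
      rcases Finset.mem_cons.1 hs with rfl | hs
      · exact absurd rfl hsa
      · by_cases hst : s = t
        · exact hst ▸ h1
        · exact (h s hs hst).trans (hf t).pos h1

/-- Induction on the number of scales, splitting off the dominant one. The function `h` stands for
the next larger scale: a permutation short compared with `h n` can be repeated and padded within a
block of that level. The induction hypothesis is applied with `h` equal to the dominant scale. -/
theorem eventually_exists_allGood {f : ℕ → ℕ → ℝ} (hf : ∀ t, IsScalingFunction (f t))
    (hdom : ∀ s t, s ≠ t → Dominated (f s) (f t) ∨ Dominated (f t) (f s))
    {X X' : Permutation → ℝ} {Ξ Ξ' : ℕ → Permutation → ℝ}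
    (hΞ : ∀ t, IsScaleLimit (Ξ t)) (hΞ' : ∀ t, IsScaleLimit (Ξ' t))
    (hX : ∀ π, X π ≤ 1) (hX' : ∀ π, X' π ≤ 1) (K : ℕ)
    (hloc : ∀ ε > 0, ∃ P : Permutation, 0 < P.1 ∧ LocalGood K ε X P ∧ LocalGood K ε X' P.inverse)
    (k : ℕ) : ∀ F : Finset ℕ, F.card = k → ∀ h : ℕ → ℝ, Tendsto h atTop atTop →
      (∀ t ∈ F, Dominated (f t) h) → ∀ ε > 0, ∀ᶠ n in atTop, ∃ P : Permutation,
        0 < P.1 ∧ (P.1 : ℝ) ≤ ε * h n ∧ AllGood F K ε (fun t => f t n) X X' Ξ Ξ' P := by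
  induction k with
  | zero =>
    intro F hF h hh _ ε hε
    obtain ⟨P, hP, h1, h2⟩ := hloc ε hε
    rw [Finset.card_eq_zero] at hF
    subst hF
    filter_upwards [hh.eventually_ge_atTop (P.1 / ε)] with n hn
    refine ⟨P, hP, ?_, h1, h2, by simp, by simp⟩
    rw [div_le_iff₀ hε] at hn
    linarith
  | succ k ih =>
    intro F hF h hh hFh ε hε
    obtain ⟨t, ht, hmax⟩ := exists_dominant hf hdom F (Finset.card_pos.1 (by omega))
    -- Two losses of `δ` must fit into `ε`: approximation and padding for the smaller scales,
    -- approximation and rounding for the dominant one. The cap at 1 keeps the padded fraction at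
    -- most 1.
    set δ : ℝ := min ε 1 / 2 with hδdef
    have hδ0 : 0 < δ := by positivity
    have hδ1 : δ ≤ 1 := by
      have := min_le_right ε 1
      linarith
    have hδε : 2 * δ ≤ ε := by
      have := min_le_left ε 1
      linarith
    obtain ⟨v, hv, S, hS, hS1, hS2⟩ := exists_scaleGood_both (hΞ t) (hΞ' t) K hδ0
    have hv0 : (0 : ℝ) < v := by exact_mod_cast hv
    have hS0 : (0 : ℝ) < S.1 := by exact_mod_cast hS
    have hft := (hf t).tendsto_atTop
    have hih := ih (F.erase t) (by rw [Finset.card_erase_of_mem ht, hF]; rfl) (f t) hft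
      (fun s hs => hmax s (Finset.mem_of_mem_erase hs) (Finset.ne_of_mem_erase hs))
      -- The block length `u` below satisfies f ≤ v(u + 1) ≤ 2vu, so this bound gives `|P| ≤ δ * u`.
      (δ / (2 * v)) (by positivity)
    have hpow : ∀ᶠ n in atTop, ∀ m ∈ Set.Iic K, 1 - δ ≤ (1 - v / f t n) ^ m := by
      refine (eventually_all_finite (Set.finite_Iic K)).2 fun m _ => ?_
      have h1 : Tendsto (fun n => (1 - v / f t n) ^ m) atTop (𝓝 ((1 - 0) ^ m)) :=
        (tendsto_const_nhds.sub (hft.const_div_atTop _)).pow m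
      simp only [sub_zero, one_pow] at h1
      exact h1.eventually_const_le (by linarith)
    have hsmall := (hFh t ht).eventually_le_const (show 0 < ε / S.1 by positivity)
    filter_upwards [hih, hpow, hsmall, hft.eventually_ge_atTop v, hh.eventually_gt_atTop 0,
      eventually_ge_atTop 1] with n hn hn1 hn2 hn3 hn4 hn5
    obtain ⟨P, hP, hPle, hPg⟩ := hn
    have hwpos : ∀ t, 0 ≤ f t n := fun t => ((hf t).pos n hn5).le
    have hf0 : 0 < f t n := (hf t).pos n hn5
    -- With blocks of length `u`, the good scale `v` of `S` becomes `v * u`, which falls short of `f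
    -- t n` by at most `v`.
    set u := ⌊f t n / v⌋₊ with hu
    have hu1 : 1 ≤ u := by
      rw [hu, Nat.one_le_floor_iff, le_div_iff₀ hv0]
      linarith
    have hu1' : (1 : ℝ) ≤ u := by exact_mod_cast hu1
    have huf : v * (u : ℝ) ≤ f t n := by
      have := Nat.floor_le (show 0 ≤ f t n / v by positivity)
      rw [le_div_iff₀ hv0] at this
      linarith
    have hfu : f t n ≤ v * (u + 1) := by
      have := (Nat.lt_floor_add_one (f t n / v)).le
      rw [div_le_iff₀ hv0] at this
      linarith
    have hPu : (P.1 : ℝ) ≤ δ * u := by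
      calc (P.1 : ℝ) ≤ δ / (2 * v) * f t n := hPle
        _ ≤ δ / (2 * v) * (v * (2 * u)) := by
            refine mul_le_mul_of_nonneg_left (hfu.trans ?_) (by positivity)
            refine mul_le_mul_of_nonneg_left (by linarith) hv0.le
        _ = δ * u := by field_simp
    have hpw : ∀ m ≤ K, (1 - δ) * f t n ^ m ≤ (v * (u : ℝ)) ^ m := by
      intro m hm
      have h1 := hn1 m hm
      calc (1 - δ) * f t n ^ m ≤ (1 - v / f t n) ^ m * f t n ^ m := by
            refine mul_le_mul_of_nonneg_right h1 (by positivity)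
        _ = (f t n - v) ^ m := by
            rw [← mul_pow]
            congr 1
            field_simp
        _ ≤ _ := by
            refine pow_le_pow_left₀ (by linarith) ?_ m
            linarith
    have hall := (hPg.mono hwpos (show δ / (2 * v) ≤ δ by
      refine div_le_self hδ0.le ?_
      have : (1 : ℝ) ≤ v := by exact_mod_cast hv
      linarith)).inflate_padTo hX hX'
      (fun t => (hΞ t).le_one) (fun t => (hΞ' t).le_one) hwpos hδ0.le hδ0.le hδ1 hP S hPu
    have hall' := hall.mono hwpos (show δ + δ ≤ ε by linarith)
    refine ⟨inflate S (padTo P u), ?_, ?_, hall'.loc, hall'.locInv, fun s hs => ?_,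
      fun s hs => ?_⟩
    · rw [inflate_padTo_fst]
      exact Nat.mul_pos hS hu1
    · rw [inflate_padTo_fst]
      push_cast
      rw [div_le_div_iff₀ hn4 hS0] at hn2
      have huf' : (u : ℝ) ≤ f t n := by
        have : (1 : ℝ) ≤ v := by exact_mod_cast hv
        nlinarith
      nlinarith
    · by_cases hst : s = t
      · subst hst
        have h1 := hS1.inflate hv0.le (padTo P u)
        rw [padTo_fst] at h1
        exact (h1.scale (by positivity) huf hδ0.le (hΞ s).le_one hpw).mono hf0.le hδε
      · exact hall'.scale s (Finset.mem_erase.2 ⟨hst, hs⟩)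
    · by_cases hst : s = t
      · subst hst
        have h1 := hS2.inflate hv0.le (padTo P u).inverse
        rw [inverse_padTo, padTo_fst] at h1
        exact (h1.scale (by positivity) huf hδ0.le (hΞ' s).le_one hpw).mono hf0.le hδε
      · exact hall'.scaleInv s (Finset.mem_erase.2 ⟨hst, hs⟩)

/-! ### Finite approximation of local limits -/

/-- The infinite permutation `r` induces the pattern `π` on the indices `i, i + 1, ...`. -/
def patternEvent (π : Permutation) (i : ℕ) : Set InfiniteRootedPermutation :=
  {r | ∀ a b : Fin π.1, r.1 ((i : ℤ) + (a : ℕ)) ((i : ℤ) + (b : ℕ)) ↔ π.2 a < π.2 b}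

theorem measurableSet_patternEvent (π : Permutation) (i : ℕ) :
    MeasurableSet (patternEvent π i) := by
  unfold patternEvent
  rw [measurableSet_setOfPred]
  refine Measurable.forall fun a => Measurable.forall fun b => ?_
  have h1 : Measurable (fun r : InfiniteRootedPermutation =>
      r.1 ((i : ℤ) + (a : ℕ)) ((i : ℤ) + (b : ℕ))) :=
    (measurable_pi_apply ((i : ℤ) + (b : ℕ))).comp
      ((measurable_pi_apply ((i : ℤ) + (a : ℕ))).comp measurable_subtype_coe)
  exact h1.iff measurable_const

theorem SIRIRP.real_patternEvent (Λ : SIRIRP) (π : Permutation) (i : ℕ) :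
    Λ.measure.real (patternEvent π i) = Λ.density π := by
  induction i with
  | zero =>
    unfold patternEvent SIRIRP.density
    simp
  | succ i ih =>
    rw [← ih]
    have h := Λ.shift_invariant.measure_preimage (measurableSet_patternEvent π i).nullMeasurableSet
    rw [Measure.real, Measure.real, ← h]
    congr 2
    ext r
    simp only [patternEvent, Set.mem_preimage, Set.mem_ofPred_eq,
      InfiniteRootedPermutation.shift, Nat.cast_succ]
    refine forall₂_congr fun a b => ?_
    rw [add_right_comm (i : ℤ) 1, add_right_comm (i : ℤ) 1]

theorem exists_mem_patternEvent (r : InfiniteRootedPermutation) (k i : ℕ) :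
    ∃ π : Equiv.Perm (Fin k), r ∈ patternEvent ⟨k, π⟩ i := by
  obtain ⟨π, hπ⟩ := exists_pattern
    (fun a b : Fin k => r.1 ((i : ℤ) + (a : ℕ)) ((i : ℤ) + (b : ℕ)))
    (fun a => r.2.1 _) (fun a b c => r.2.2.1 _ _ _)
    (fun a b hab => r.2.2.2 _ _ (fun h => hab (Fin.ext (by omega))))
  exact ⟨π, hπ⟩

theorem SIRIRP.sum_density (Λ : SIRIRP) (k : ℕ) :
    ∑ π : Equiv.Perm (Fin k), Λ.density ⟨k, π⟩ = 1 := by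
  have := Λ.isProbabilityMeasure
  simp only [← Λ.real_patternEvent _ 0]
  rw [← measureReal_biUnion_finset]
  · have : (⋃ π ∈ (Finset.univ : Finset (Equiv.Perm (Fin k))), patternEvent ⟨k, π⟩ 0) =
        Set.univ := by
      refine Set.eq_univ_of_forall fun r => ?_
      obtain ⟨π, hπ⟩ := exists_mem_patternEvent r k 0
      exact Set.mem_biUnion (Finset.mem_univ π) hπ
    rw [this]
    exact probReal_univ
  · intro π _ π' _ hne
    rw [Function.onFun, Set.disjoint_left]
    intro r h h'
    exact hne (perm_eq_of_lt_iff fun a b => (h a b).symm.trans (h' a b))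
  · exact fun π _ => measurableSet_patternEvent _ _

theorem SIRIRP.density_le_one (Λ : SIRIRP) (π : Permutation) : Λ.density π ≤ 1 := by
  have := Λ.isProbabilityMeasure
  exact measureReal_le_one

theorem SIRIRP.density_nonneg (Λ : SIRIRP) (π : Permutation) : 0 ≤ Λ.density π :=
  measureReal_nonneg

/-- The pattern `π` occurs in `τ` on the indices `i, i + 1, ...`. -/
def OccursFrom (π : Permutation) {M : ℕ} (τ : Equiv.Perm (Fin M)) (i : ℕ) : Prop :=
  ∃ h : i + π.1 ≤ M, ∀ a b : Fin π.1,
    τ ⟨i + a, by omega⟩ < τ ⟨i + b, by omega⟩ ↔ π.2 a < π.2 b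

open Classical in
theorem card_occursFrom_le (π : Permutation) (hπ : 1 ≤ π.1) {M : ℕ} (τ : Equiv.Perm (Fin M)) :
    ((Finset.range (M + 1 - π.1)).filter (OccursFrom π τ)).card ≤ occAt π.1 π ⟨M, τ⟩ := by
  rcases Nat.eq_zero_or_pos M with rfl | hM
  · rw [show 0 + 1 - π.1 = 0 by omega, Finset.range_zero, Finset.filter_empty, Finset.card_empty]
    exact Nat.zero_le _
  rw [occAt_eq (Nat.cast_nonneg _), ← Set.ncard_coe_finset]
  have hmem : ∀ i ∈ (((Finset.range (M + 1 - π.1)).filter (OccursFrom π τ) : Finset ℕ) : Set ℕ),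
      OccursFrom π τ i := fun i hi => (Finset.mem_filter.1 (Finset.mem_coe.1 hi)).2
  refine Set.ncard_le_ncard_of_injOn
    (fun i a => if h : i + π.1 ≤ M then (⟨i + a, by omega⟩ : Fin M) else ⟨0, hM⟩)
    (fun i hi => ?_) (fun i hi j hj hij => ?_) (Set.toFinite _)
  · obtain ⟨h, H⟩ := hmem i hi
    simp only [h, dif_pos]
    refine ⟨fun a b hab => Fin.lt_def.2 (Nat.add_lt_add_left hab i), H, fun a b => ?_⟩
    have h1 : ((b : ℕ) : ℝ) + 1 ≤ π.1 := by exact_mod_cast b.2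
    have h2 : (0 : ℝ) ≤ (a : ℕ) := Nat.cast_nonneg _
    push_cast
    linarith
  · obtain ⟨h, -⟩ := hmem i hi
    obtain ⟨h', -⟩ := hmem j hj
    simp only [h, h', dif_pos] at hij
    have := congrArg Fin.val (congrFun hij ⟨0, hπ⟩)
    simpa using this

-- The window of length `|π|` starting at `i` lies within the first `M` indices, so the pattern `τ`
-- seen there decides whether `π` occurs at `i`.
open Classical in
theorem SIRIRP.density_le_sum (Λ : SIRIRP) (π : Permutation) {M i : ℕ} (h : i + π.1 ≤ M) :
    Λ.density π ≤ ∑ τ : Equiv.Perm (Fin M) with OccursFrom π τ i, Λ.density ⟨M, τ⟩ := by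
  have := Λ.isProbabilityMeasure
  simp only [← Λ.real_patternEvent ⟨M, _⟩ 0]
  rw [← Λ.real_patternEvent π i]
  refine le_trans (measureReal_mono ?_ (measure_ne_top _ _)) (measureReal_biUnion_finset_le _ _)
  intro r hr
  obtain ⟨τ, hτ⟩ := exists_mem_patternEvent r M 0
  refine Set.mem_biUnion (x := τ) ?_ hτ
  simp only [Finset.coe_filter, Finset.mem_univ, true_and, Set.mem_ofPred_eq]
  refine ⟨h, fun a b => ?_⟩
  have h1 := hτ (⟨i + a, by omega⟩ : Fin M) (⟨i + b, by omega⟩ : Fin M)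
  have h2 := hr a b
  simp only [Nat.cast_zero, zero_add, Nat.cast_add] at h1
  exact h1.symm.trans h2

/-- A probability distribution on a finite type is nearly the distribution of the entries of some
finite list. -/
theorem exists_fin_fun_card_fiber_ge {α : Type*} [Fintype α] [DecidableEq α] (p : α → ℝ)
    (hp : ∀ x, 0 ≤ p x) (hsum : ∑ x, p x = 1) {η : ℝ} (hη : 0 < η) :
    ∃ q : ℕ, 0 < q ∧ ∃ F : Fin q → α, ∀ x,
      (p x - η) * q ≤ (Finset.univ.filter (fun c => F c = x)).card := by
  -- Each `x` is listed `⌊p x * Q⌋₊` times. The bound `Q > 1 / η` absorbs the rounding, and `Q >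
  -- |α|` makes the list nonempty.
  obtain ⟨Q, hQ⟩ := exists_nat_gt (max (1 / η) (Fintype.card α))
  have hQ1 : 1 / η < Q := (le_max_left _ _).trans_lt hQ
  have hQ2 : (Fintype.card α : ℝ) < Q := (le_max_right _ _).trans_lt hQ
  have hQ0 : (0 : ℝ) ≤ Q := Nat.cast_nonneg _
  rw [div_lt_iff₀ hη] at hQ1
  have hfl : ∀ x, p x * Q - 1 ≤ (⌊p x * Q⌋₊ : ℝ) := fun x => (Nat.sub_one_lt_floor _).le
  have hfl' : ∀ x, (⌊p x * Q⌋₊ : ℝ) ≤ p x * Q := fun x =>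
    Nat.floor_le (mul_nonneg (hp x) hQ0)
  have hcard : Fintype.card (Σ x : α, Fin ⌊p x * Q⌋₊) = ∑ x, ⌊p x * Q⌋₊ := by simp
  let e := Fintype.equivFinOfCardEq hcard
  have hqle : ((∑ x, ⌊p x * Q⌋₊ : ℕ) : ℝ) ≤ Q := by
    push_cast
    calc ∑ x, (⌊p x * Q⌋₊ : ℝ) ≤ ∑ x, p x * Q := Finset.sum_le_sum fun x _ => hfl' x
      _ = Q := by rw [← Finset.sum_mul, hsum, one_mul]
  refine ⟨∑ x, ⌊p x * Q⌋₊, ?_, fun c => (e.symm c).1, fun x => ?_⟩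
  · have h1 : (0 : ℝ) < ((∑ x, ⌊p x * Q⌋₊ : ℕ) : ℝ) := by
      push_cast
      calc (0 : ℝ) < Q - Fintype.card α := by linarith
        _ = ∑ x, (p x * Q - 1) := by
          rw [Finset.sum_sub_distrib, ← Finset.sum_mul, hsum, one_mul]; simp
        _ ≤ _ := Finset.sum_le_sum fun x _ => hfl x
    exact_mod_cast h1
  · have hfib : (Finset.univ.filter (fun c => (e.symm c).1 = x)).card = ⌊p x * Q⌋₊ := by
      rw [Finset.card_equiv (t := Finset.univ.filter
        (fun y : Σ x : α, Fin ⌊p x * Q⌋₊ => y.1 = x)) e.symm (by simp)]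
      have : (Finset.univ.filter (fun y : Σ x : α, Fin ⌊p x * Q⌋₊ => y.1 = x)) =
          (Finset.univ : Finset (Fin ⌊p x * Q⌋₊)).map ⟨Sigma.mk x, sigma_mk_injective⟩ := by
        ext ⟨y, j⟩
        simp only [Finset.mem_filter, Finset.mem_univ, true_and, Finset.mem_map,
          Function.Embedding.coeFn_mk]
        constructor
        · rintro rfl
          exact ⟨j, rfl⟩
        · rintro ⟨i, hi⟩
          exact (congrArg Sigma.fst hi).symm
      rw [this, Finset.card_map, Finset.card_univ, Fintype.card_fin]
    rw [hfib]
    rcases le_or_gt (p x - η) 0 with h | h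
    · exact (mul_nonpos_of_nonpos_of_nonneg h (Nat.cast_nonneg _)).trans (Nat.cast_nonneg _)
    · calc (p x - η) * ((∑ x, ⌊p x * Q⌋₊ : ℕ) : ℝ) ≤ (p x - η) * Q :=
          mul_le_mul_of_nonneg_left hqle h.le
        _ ≤ p x * Q - 1 := by linarith
        _ ≤ _ := hfl x

theorem occAt_length_le (π : Permutation) (hπ : 1 ≤ π.1) (σ : Permutation) :
    occAt π.1 π σ ≤ σ.1 := by
  obtain ⟨m, hm⟩ : ∃ m, π.1 = m + 1 := ⟨π.1 - 1, by omega⟩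
  refine (occAt_le_chooseAt _ _ _).trans ?_
  have := chooseAt_le_choose (f := (π.1 : ℝ)) (Nat.cast_nonneg _) σ.1 m
  rw [Nat.floor_natCast, ← hm, show π.1 - 1 = m by omega, Nat.choose_self, mul_one] at this
  exact this

/-- Take a direct sum of patterns of length `M` whose frequencies are nearly their probabilities
under `Λ`. By shift invariance, each of the `M + 1 - |π|` positions inside a random window shows `π`
with probability `Λ.density π`; windows crossing a boundary are discarded. -/
theorem SIRIRP.exists_localGood (Λ : SIRIRP) (K : ℕ) {ε : ℝ} (hε : 0 < ε) :
    ∃ A : Permutation, 0 < A.1 ∧ LocalGood K ε Λ.density A := by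
  classical
  -- The boundary positions cost at most K/M < ε/2.
  obtain ⟨M, hM⟩ := exists_nat_gt (max (2 * K / ε) K)
  have hM1 : 2 * K / ε < M := (le_max_left _ _).trans_lt hM
  have hM2 : K < M := by exact_mod_cast (le_max_right _ _).trans_lt hM
  rw [div_lt_iff₀ hε] at hM1
  have hM0 : (0 : ℝ) < M := by exact_mod_cast (by omega : 0 < M)
  set C : ℝ := (Fintype.card (Equiv.Perm (Fin M)) : ℝ) with hC
  have hC0 : 0 < C := by rw [hC]; exact_mod_cast Fintype.card_pos
  -- There are `C` patterns `τ`, each with at most `M` occurrences, so frequency errors of `ε / (2 *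
  -- C)` cost at most ε/2 of the length.
  obtain ⟨q, hq, F, hF⟩ := exists_fin_fun_card_fiber_ge
    (fun τ : Equiv.Perm (Fin M) => Λ.density ⟨M, τ⟩) (fun _ => Λ.density_nonneg _)
    (Λ.sum_density M) (η := ε / (2 * C)) (by positivity)
  have hq0 : (0 : ℝ) < q := by exact_mod_cast hq
  refine ⟨⟨q * M, directSumPerm F⟩, Nat.mul_pos hq (by omega), fun π h1 h2 => ?_⟩
  have hs : ((∑ c, occAt π.1 π ⟨M, F c⟩ : ℕ) : ℝ) ≤ occAt π.1 π ⟨q * M, directSumPerm F⟩ :=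
    Nat.cast_le.2 (sum_occAt_le_directSumPerm F (Nat.cast_nonneg _) h1)
  refine le_trans ?_ hs
  have hfib : ∑ c, occAt π.1 π ⟨M, F c⟩ = ∑ τ : Equiv.Perm (Fin M),
      (Finset.univ.filter (fun c => F c = τ)).card * occAt π.1 π ⟨M, τ⟩ := by
    rw [← Finset.sum_fiberwise (g := F)]
    refine Finset.sum_congr rfl fun τ _ => ?_
    rw [Finset.sum_congr rfl (g := fun _ => occAt π.1 π ⟨M, τ⟩), Finset.sum_const, smul_eq_mul]
    intro c hc
    rw [(Finset.mem_filter.1 hc).2]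
  have hlow : ((M : ℝ) - K) * Λ.density π ≤
      ∑ τ : Equiv.Perm (Fin M), Λ.density ⟨M, τ⟩ * occAt π.1 π ⟨M, τ⟩ := by
    calc ((M : ℝ) - K) * Λ.density π
        ≤ ((M + 1 - π.1 : ℕ) : ℝ) * Λ.density π := by
          refine mul_le_mul_of_nonneg_right ?_ (Λ.density_nonneg _)
          rw [Nat.cast_sub (by omega)]
          have : (π.1 : ℝ) ≤ K := Nat.cast_le.2 h2
          push_cast
          linarith
      _ = ∑ i ∈ Finset.range (M + 1 - π.1), Λ.density π := by simp
      _ ≤ ∑ i ∈ Finset.range (M + 1 - π.1),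
          ∑ τ : Equiv.Perm (Fin M) with OccursFrom π τ i, Λ.density ⟨M, τ⟩ := by
          refine Finset.sum_le_sum fun i hi => Λ.density_le_sum π ?_
          have := Finset.mem_range.1 hi
          omega
      _ = ∑ τ : Equiv.Perm (Fin M), ∑ i ∈ Finset.range (M + 1 - π.1) with OccursFrom π τ i,
          Λ.density ⟨M, τ⟩ := by
          simp only [Finset.sum_filter]
          exact Finset.sum_comm
      _ ≤ _ := by
          refine Finset.sum_le_sum fun τ _ => ?_
          rw [Finset.sum_const, nsmul_eq_mul, mul_comm]
          exact mul_le_mul_of_nonneg_left (Nat.cast_le.2 (card_occursFrom_le π h1 τ))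
            (Λ.density_nonneg _)
  rw [hfib]
  push_cast
  have hle1 := Λ.density_le_one π
  have hge0 := Λ.density_nonneg π
  calc (Λ.density π - ε) * (q * M)
      ≤ (((M : ℝ) - K) * Λ.density π - ε / (2 * C) * (C * M)) * q := by
        have : ε / (2 * C) * (C * M) = ε * M / 2 := by field_simp
        rw [this]
        have h5 : (K : ℝ) * Λ.density π ≤ K := mul_le_of_le_one_right (Nat.cast_nonneg _) hle1
        rw [show (Λ.density π - ε) * (q * M) = ((Λ.density π - ε) * M) * q by ring]
        refine mul_le_mul_of_nonneg_right ?_ hq0.le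
        nlinarith
    _ ≤ (∑ τ : Equiv.Perm (Fin M), Λ.density ⟨M, τ⟩ * occAt π.1 π ⟨M, τ⟩ -
          ∑ τ : Equiv.Perm (Fin M), ε / (2 * C) * occAt π.1 π ⟨M, τ⟩) * q := by
        refine mul_le_mul_of_nonneg_right (sub_le_sub hlow ?_) hq0.le
        rw [← Finset.mul_sum]
        refine mul_le_mul_of_nonneg_left ?_ (by positivity)
        calc ∑ τ : Equiv.Perm (Fin M), (occAt π.1 π ⟨M, τ⟩ : ℝ)
            ≤ ∑ _τ : Equiv.Perm (Fin M), (M : ℝ) :=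
              Finset.sum_le_sum fun τ _ => Nat.cast_le.2 (occAt_length_le π h1 ⟨M, τ⟩)
          _ = C * M := by rw [Finset.sum_const, nsmul_eq_mul, hC, Finset.card_univ]
    _ = ∑ τ : Equiv.Perm (Fin M), (Λ.density ⟨M, τ⟩ - ε / (2 * C)) * q *
          occAt π.1 π ⟨M, τ⟩ := by
        rw [← Finset.sum_sub_distrib, Finset.sum_mul]
        refine Finset.sum_congr rfl fun τ _ => by ring
    _ ≤ _ := Finset.sum_le_sum fun τ _ =>
        mul_le_mul_of_nonneg_right (hF τ) (Nat.cast_nonneg _)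

/-! ### Sampling from a permuton -/

section Sampling

variable {E : Type*} [MeasurableSpace E] (μ : Measure E) [IsProbabilityMeasure μ]

theorem measurePreserving_comp_injective {ι κ : Type*} [Fintype ι] [Fintype κ] {g : ι → κ}
    (hg : Function.Injective g) :
    MeasurePreserving (fun (ω : κ → E) i => ω (g i)) (Measure.pi fun _ => μ)
      (Measure.pi fun _ => μ) := by
  refine ⟨measurable_pi_lambda _ fun i => measurable_pi_apply _, ?_⟩
  have h := (ProbabilityTheory.iIndepFun_pi (μ := fun _ : κ => μ) (X := fun _ => (id : E → E))
    (fun _ => aemeasurable_id)).precomp hg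
  have h2 := h.map_fun_eq_pi_map fun i => (measurable_pi_apply (g i)).aemeasurable
  refine h2.trans ?_
  congr 1
  funext i
  exact (measurePreserving_eval (fun _ : κ => μ) (g i)).map_eq

/-- If `e` and `e'` use distinct indices throughout, the two subsamples are independent and the
expectation factors. -/
theorem integral_mul_eq_zero_of_injective {k N : ℕ} {y : (Fin k → E) → ℝ} (hm : Measurable y)
    (hy : ∫ p, y p ∂(Measure.pi fun _ : Fin k => μ) = 0) {e e' : Fin k → Fin N}
    (h : Function.Injective (Sum.elim e e')) :
    ∫ ω, y (fun a => ω (e a)) * y (fun a => ω (e' a)) ∂(Measure.pi fun _ : Fin N => μ) = 0 := by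
  have h1 := measurePreserving_comp_injective μ h
  have h2 := measurePreserving_sumPiEquivProdPi (X := fun _ : Fin k ⊕ Fin k => E) (fun _ => μ)
  have h3 := h2.comp h1
  have hm2 : Measurable (fun z : (Fin k → E) × (Fin k → E) => y z.1 * y z.2) :=
    (hm.comp measurable_fst).mul (hm.comp measurable_snd)
  have h4 := integral_map (μ := Measure.pi fun _ : Fin N => μ) h3.measurable.aemeasurable
    (f := fun z : (Fin k → E) × (Fin k → E) => y z.1 * y z.2) hm2.aestronglyMeasurable
  rw [h3.map_eq, integral_prod_mul, hy, zero_mul] at h4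
  exact h4.symm

-- Expand the square. Only the pairs whose indices are not all distinct contribute, each at most 1,
-- and there are N^(2k) minus the falling factorial of them.
open Classical in
theorem integral_sq_sum_le {k N : ℕ} {y : (Fin k → E) → ℝ} (hm : Measurable y)
    (hb : ∀ p, |y p| ≤ 1) (hy : ∫ p, y p ∂(Measure.pi fun _ : Fin k => μ) = 0) :
    ∫ ω, (∑ e : Fin k → Fin N, y (fun a => ω (e a))) ^ 2 ∂(Measure.pi fun _ : Fin N => μ) ≤
      (N : ℝ) ^ (2 * k) - (N.descFactorial (2 * k) : ℝ) := by
  have hmy : ∀ e : Fin k → Fin N, Measurable fun ω : Fin N → E => y (fun a => ω (e a)) :=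
    fun e => hm.comp (measurable_pi_lambda _ fun a => measurable_pi_apply _)
  have hb2 : ∀ (e e' : Fin k → Fin N) (ω : Fin N → E),
      ‖y (fun a => ω (e a)) * y (fun a => ω (e' a))‖ ≤ 1 := fun e e' ω => by
    rw [Real.norm_eq_abs, abs_mul]
    exact mul_le_one₀ (hb _) (abs_nonneg _) (hb _)
  have hint : ∀ e e' : Fin k → Fin N, Integrable
      (fun ω : Fin N → E => y (fun a => ω (e a)) * y (fun a => ω (e' a)))
      (Measure.pi fun _ : Fin N => μ) := fun e e' =>
    Integrable.of_bound ((hmy e).mul (hmy e')).aestronglyMeasurable 1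
      (Eventually.of_forall fun ω => hb2 e e' ω)
  have hle : ∀ e e' : Fin k → Fin N,
      ∫ ω, y (fun a => ω (e a)) * y (fun a => ω (e' a)) ∂(Measure.pi fun _ : Fin N => μ) ≤
        if Function.Injective (Sum.elim e e') then 0 else 1 := fun e e' => by
    split_ifs with h
    · exact (integral_mul_eq_zero_of_injective μ hm hy h).le
    · have h1 := norm_integral_le_of_norm_le_const (μ := Measure.pi fun _ : Fin N => μ)
        (Eventually.of_forall fun ω => hb2 e e' ω)
      rw [probReal_univ, mul_one] at h1
      exact (le_abs_self _).trans h1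
  have hcard : ∑ e : Fin k → Fin N, ∑ e' : Fin k → Fin N,
      (if Function.Injective (Sum.elim e e') then (0 : ℝ) else 1) =
        (N : ℝ) ^ (2 * k) - (N.descFactorial (2 * k) : ℝ) := by
    rw [← Fintype.sum_prod_type' (f := fun e e' : Fin k → Fin N =>
      (if Function.Injective (Sum.elim e e') then (0 : ℝ) else 1))]
    rw [← Equiv.sum_comp (Equiv.sumArrowEquivProdArrow (Fin k) (Fin k) (Fin N))]
    have h1 : ∀ g : Fin k ⊕ Fin k → Fin N,
        (if Function.Injective (Sum.elim ((Equiv.sumArrowEquivProdArrow (Fin k) (Fin k) (Fin N)) g).1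
          ((Equiv.sumArrowEquivProdArrow (Fin k) (Fin k) (Fin N)) g).2) then (0 : ℝ) else 1) =
        1 - if Function.Injective g then (1 : ℝ) else 0 := fun g => by
      have : Sum.elim ((Equiv.sumArrowEquivProdArrow (Fin k) (Fin k) (Fin N)) g).1
          ((Equiv.sumArrowEquivProdArrow (Fin k) (Fin k) (Fin N)) g).2 = g := by
        ext (a | a) <;> rfl
      rw [this]
      split_ifs <;> simp
    rw [Finset.sum_congr rfl fun g _ => h1 g, Finset.sum_sub_distrib, Finset.sum_boole,
      ← Fintype.card_subtype,
      Fintype.card_congr (Equiv.subtypeInjectiveEquivEmbedding (Fin k ⊕ Fin k) (Fin N)),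
      Fintype.card_embedding_eq]
    simp [two_mul]
  rw [← hcard]
  simp only [sq, Finset.sum_mul_sum]
  rw [integral_finsetSum _ fun e _ => integrable_finsetSum _ fun e' _ => hint e e']
  refine Finset.sum_le_sum fun e _ => ?_
  rw [integral_finsetSum _ fun e' _ => hint e e']
  exact Finset.sum_le_sum fun e' _ => hle e e'

end Sampling

theorem tendsto_descFactorial_div_pow (m : ℕ) :
    Tendsto (fun N : ℕ => (N.descFactorial m : ℝ) / (N : ℝ) ^ m) atTop (𝓝 1) := by
  have h1 : Tendsto (fun N : ℕ => (1 - (m : ℝ) / N) ^ m) atTop (𝓝 ((1 - 0) ^ m)) :=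
    (tendsto_const_nhds.sub (tendsto_const_div_atTop_nhds_zero_nat _)).pow m
  simp only [sub_zero, one_pow] at h1
  refine tendsto_of_tendsto_of_tendsto_of_le_of_le' h1 tendsto_const_nhds ?_ ?_
  · filter_upwards [eventually_ge_atTop (m + 1)] with N hN
    have hN0 : (0 : ℝ) < N := by exact_mod_cast (by omega : 0 < N)
    rw [le_div_iff₀ (by positivity), ← mul_pow]
    have h2 : (((N + 1 - m) ^ m : ℕ) : ℝ) ≤ N.descFactorial m :=
      Nat.cast_le.2 (Nat.pow_sub_le_descFactorial N m)
    refine le_trans ?_ h2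
    have h3 : (1 - (m : ℝ) / N) * N = N - m := by field_simp
    have h4 : (m : ℝ) + 1 ≤ N := by exact_mod_cast hN
    push_cast [Nat.cast_sub (show m ≤ N + 1 by omega)]
    rw [h3]
    exact pow_le_pow_left₀ (by linarith) (by linarith) m
  · filter_upwards [eventually_ge_atTop 1] with N hN
    refine div_le_one_of_le₀ ?_ (by positivity)
    exact_mod_cast Nat.descFactorial_le_pow N m

theorem inducesPattern_unique {k : ℕ} {π π' : Equiv.Perm (Fin k)}
    {p : Fin k → unitInterval × unitInterval} (h : InducesPattern ⟨k, π⟩ p)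
    (h' : InducesPattern ⟨k, π'⟩ p) : π = π' := by
  obtain ⟨s, hs, H⟩ := h
  obtain ⟨s', hs', H'⟩ := h'
  have hr : (fun a => (p (s a)).1) = fun a => (p (s' a)).1 := by
    refine (StrictMono.range_inj hs hs').1 ?_
    have h1 := s.surjective.range_comp (fun a => (p a).1)
    have h2 := s'.surjective.range_comp (fun a => (p a).1)
    exact h1.trans h2.symm
  have hss : s = s' := by
    ext a
    have h1 := congrFun hr a
    have h2 : (p (s a)).1 = (p (s (s.symm (s' a)))).1 := by rw [Equiv.apply_symm_apply]; exact h1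
    have h3 := hs.injective h2
    rw [show s a = s (s.symm (s' a)) from congrArg s h3, Equiv.apply_symm_apply]
  subst hss
  exact perm_eq_of_lt_iff fun a b => (H a b).symm.trans (H' a b)

theorem exists_strictMono_fst {n : ℕ} {p : Fin n → unitInterval × unitInterval}
    (h : Function.Injective fun i => (p i).1) :
    ∃ s : Equiv.Perm (Fin n), StrictMono fun a => (p (s a)).1 :=
  ⟨Tuple.sort fun i => (p i).1, (Tuple.monotone_sort _).strictMono_of_injective
    (h.comp (Tuple.sort fun i => (p i).1).injective)⟩

theorem exists_inducesPattern {n : ℕ} {p : Fin n → unitInterval × unitInterval}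
    (h1 : Function.Injective fun i => (p i).1) (h2 : Function.Injective fun i => (p i).2) :
    ∃ σ : Equiv.Perm (Fin n), InducesPattern ⟨n, σ⟩ p := by
  obtain ⟨s, hs⟩ := exists_strictMono_fst h1
  obtain ⟨σ, hσ⟩ := exists_pattern (fun a b => (p (s a)).2 < (p (s b)).2) (fun _ => lt_irrefl _)
    (fun _ _ _ => lt_trans)
    (fun a b hab => lt_or_gt_of_ne (fun h => hab (s.injective (h2 h))))
  exact ⟨σ, s, hs, hσ⟩

theorem measurableSet_inducesPattern (π : Permutation) :
    MeasurableSet {p | InducesPattern π p} := by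
  rw [measurableSet_setOfPred]
  have hlt : ∀ (g : unitInterval × unitInterval → unitInterval), Measurable g →
      ∀ i j : Fin π.1, Measurable
        fun p : Fin π.1 → unitInterval × unitInterval => g (p i) < g (p j) := fun g hg i j => by
    rw [← measurableSet_setOfPred]
    exact measurableSet_lt (hg.comp (measurable_pi_apply i)) (hg.comp (measurable_pi_apply j))
  unfold InducesPattern
  refine Measurable.exists fun s => Measurable.and ?_ ?_
  · unfold StrictMono
    exact Measurable.forall fun a => Measurable.forall fun b =>
      measurable_const.imp (hlt _ measurable_fst _ _)
  · exact Measurable.forall fun a => Measurable.forall fun b =>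
      (hlt _ measurable_snd _ _).iff measurable_const

/-- Uniform marginals have no atoms, so by Fubini two independent points almost surely differ in
each coordinate. -/
theorem Permuton.ae_injective (Γ : Permuton) (n : ℕ) :
    ∀ᵐ p ∂(Measure.pi fun _ : Fin n => Γ.measure),
      Function.Injective (fun i => (p i).1) ∧ Function.Injective (fun i => (p i).2) := by
  have := Γ.isProbabilityMeasure
  have key : ∀ (g : unitInterval × unitInterval → unitInterval), Measurable g →
      (∀ a, Γ.measure {q | g q = a} = 0) →
      ∀ᵐ p ∂(Measure.pi fun _ : Fin n => Γ.measure), Function.Injective fun i => g (p i) := by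
    intro g hg h0
    have h1 : ∀ i j : Fin n, i ≠ j →
        ∀ᵐ p ∂(Measure.pi fun _ : Fin n => Γ.measure), g (p i) ≠ g (p j) := by
      intro i j hij
      have hind := ProbabilityTheory.iIndepFun_pi (μ := fun _ : Fin n => Γ.measure)
        (X := fun _ => (id : unitInterval × unitInterval → unitInterval × unitInterval))
        (fun _ => aemeasurable_id)
      have h2 := (ProbabilityTheory.indepFun_iff_map_prod_eq_prod_map_map
        (measurable_pi_apply i).aemeasurable (measurable_pi_apply j).aemeasurable).1
        (hind.indepFun hij)
      have h3 : Measure.map (fun p : Fin n → unitInterval × unitInterval => (p i, p j))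
          (Measure.pi fun _ : Fin n => Γ.measure) = Γ.measure.prod Γ.measure := by
        refine h2.trans ?_
        congr 1
        · exact (measurePreserving_eval (fun _ : Fin n => Γ.measure) i).map_eq
        · exact (measurePreserving_eval (fun _ : Fin n => Γ.measure) j).map_eq
      have hS : MeasurableSet {z : (unitInterval × unitInterval) × (unitInterval × unitInterval) |
          g z.1 = g z.2} :=
        measurableSet_eq_fun (hg.comp measurable_fst) (hg.comp measurable_snd)
      have h4 : (Γ.measure.prod Γ.measure) {z | g z.1 = g z.2} = 0 := by
        rw [Measure.measure_prod_null hS]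
        refine Eventually.of_forall fun x => ?_
        have : Prod.mk x ⁻¹' {z : (unitInterval × unitInterval) × (unitInterval × unitInterval) |
            g z.1 = g z.2} = {q | g q = g x} := by
          ext q
          exact eq_comm
        change Γ.measure (Prod.mk x ⁻¹' _) = 0
        rw [this]
        exact h0 _
      rw [← h3, Measure.map_apply ((measurable_pi_apply i).prodMk (measurable_pi_apply j)) hS] at h4
      exact measure_eq_zero_iff_ae_notMem.1 h4
    have h5 : ∀ᵐ p ∂(Measure.pi fun _ : Fin n => Γ.measure),
        ∀ i j, i ≠ j → g (p i) ≠ g (p j) := by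
      refine ae_all_iff.2 fun i => ae_all_iff.2 fun j => ?_
      by_cases hij : i = j
      · exact Eventually.of_forall fun p h => absurd hij h
      · filter_upwards [h1 i j hij] with p hp _ using hp
    filter_upwards [h5] with p hp i j hij
    by_contra hne
    exact hp i j hne hij
  refine (key _ measurable_fst fun a => ?_).and (key _ measurable_snd fun a => ?_)
  · have h := Γ.fst_uniform a a le_rfl
    rw [sub_self, ENNReal.ofReal_zero, Set.Icc_self] at h
    refine measure_mono_null (fun q hq => ?_) h
    exact ⟨hq, Set.mem_univ _⟩
  · have h := Γ.snd_uniform a a le_rfl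
    rw [sub_self, ENNReal.ofReal_zero, Set.Icc_self] at h
    refine measure_mono_null (fun q hq => ?_) h
    exact ⟨Set.mem_univ _, hq⟩

theorem Permuton.sum_density (Γ : Permuton) (k : ℕ) :
    ∑ π : Equiv.Perm (Fin k), Γ.density ⟨k, π⟩ = 1 := by
  have := Γ.isProbabilityMeasure
  change ∑ π : Equiv.Perm (Fin k), (Measure.pi fun _ : Fin k => Γ.measure).real
    {p : Fin k → unitInterval × unitInterval | InducesPattern ⟨k, π⟩ p} = 1
  rw [← measureReal_biUnion_finset]
  · have h : (⋃ π ∈ (Finset.univ : Finset (Equiv.Perm (Fin k))), {p | InducesPattern ⟨k, π⟩ p})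
        =ᵐ[Measure.pi fun _ : Fin k => Γ.measure] Set.univ := by
      rw [eventuallyEq_univ]
      filter_upwards [Γ.ae_injective k] with p hp
      obtain ⟨π, hπ⟩ := exists_inducesPattern hp.1 hp.2
      exact Set.mem_biUnion (Finset.mem_univ π) hπ
    rw [measureReal_congr h]
    exact probReal_univ
  · intro π _ π' _ hne
    rw [Function.onFun, Set.disjoint_left]
    intro r h h'
    exact hne (inducesPattern_unique h h')
  · exact fun π _ => measurableSet_inducesPattern ⟨k, π⟩

/-- The number of maps along which the points `p` induce the pattern `π` is bounded in terms of
the number of occurrences of `π` in the permutation induced by `p`. -/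
theorem ncard_inducesPattern_le {N : ℕ} {p : Fin N → unitInterval × unitInterval}
    {σ : Equiv.Perm (Fin N)} (h : InducesPattern ⟨N, σ⟩ p) (π : Permutation) :
    {e : Fin π.1 → Fin N | InducesPattern π fun a => p (e a)}.ncard ≤
      π.1.factorial * occ π ⟨N, σ⟩ := by
  classical
  obtain ⟨s, hs, H⟩ := h
  rw [← occAt_eq_occ (f := (N : ℝ)) (σ := ⟨N, σ⟩) le_rfl, occAt_eq (Nat.cast_nonneg _)]
  have hc : π.1.factorial = (Set.univ : Set (Equiv.Perm (Fin π.1))).ncard := by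
    rw [Set.ncard_univ, Nat.card_eq_fintype_card, Fintype.card_perm, Fintype.card_fin]
  rw [hc, ← Set.ncard_prod]
  choose! s' hs' H' using fun (e : Fin π.1 → Fin N)
    (he : InducesPattern π fun a => p (e a)) => he
  -- A map is encoded by the permutation sorting its points and by the resulting increasing list of
  -- positions; the sorting permutation accounts for the factorial.
  refine Set.ncard_le_ncard_of_injOn (fun e => (s' e, fun a => s.symm (e (s' e a)))) ?_ ?_
    (Set.toFinite _)
  · intro e he
    refine ⟨Set.mem_univ _, ?_, ?_, ?_⟩
    · intro a b hab
      have h1 := hs' e he hab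
      refine hs.lt_iff_lt.1 ?_
      simpa using h1
    · intro a b
      rw [← H' e he]
      have h1 := H (s.symm (e (s' e a))) (s.symm (e (s' e b)))
      simp only [Equiv.apply_symm_apply] at h1
      exact h1.symm
    · intro a b
      have h1 : ((s.symm (e (s' e b)) : Fin N) : ℝ) + 1 ≤ N := by
        exact_mod_cast (s.symm (e (s' e b))).2
      have h2 : (0 : ℝ) ≤ ((s.symm (e (s' e a)) : Fin N) : ℕ) := Nat.cast_nonneg _
      exact h1.trans (by linarith)
  · intro e _ e' _ hee
    simp only [Prod.mk.injEq] at hee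
    obtain ⟨h1, h2⟩ := hee
    funext a
    have h3 := congrFun h2 ((s' e).symm a)
    rw [← h1] at h3
    simpa using h3

/-- For `N` independent points, the normalised squared deviations, summed over all patterns of
length at most `K`, have expectation tending to 0. Some sample with distinct coordinates therefore
has every deviation below `ε`. -/
theorem Permuton.exists_occ_ge (Γ : Permuton) (K : ℕ) {ε : ℝ} (hε : 0 < ε) :
    ∃ G : Permutation, 0 < G.1 ∧ ∀ π : Permutation, π.1 ≤ K →
      (Γ.density π - ε) * ((G.1 : ℝ) ^ π.1 / π.1.factorial) ≤ occ π G := by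
  classical
  have := Γ.isProbabilityMeasure
  set T := (finite_setOf_length_le K).toFinset with hT
  have hlim : Tendsto (fun N : ℕ => ∑ π ∈ T,
      (1 - (N.descFactorial (2 * π.1) : ℝ) / (N : ℝ) ^ (2 * π.1))) atTop (𝓝 0) := by
    have h1 := tendsto_finsetSum T fun π _ =>
      (tendsto_const_nhds (x := (1 : ℝ))).sub (tendsto_descFactorial_div_pow (2 * π.1))
    simpa using h1
  obtain ⟨N, hN1, hN2⟩ := ((hlim.eventually_lt_const (show 0 < ε ^ 2 by positivity)).and
    (eventually_ge_atTop 1)).exists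
  have hN0 : (0 : ℝ) < N := by exact_mod_cast hN2
  let y : ∀ π : Permutation, (Fin π.1 → unitInterval × unitInterval) → ℝ := fun π p =>
    Set.indicator {p | InducesPattern π p} (fun _ => 1) p - Γ.density π
  have hd0 : ∀ π, 0 ≤ Γ.density π := fun π => measureReal_nonneg
  have hd1 : ∀ π, Γ.density π ≤ 1 := fun π => measureReal_le_one
  have hym : ∀ π, Measurable (y π) := fun π =>
    (measurable_const.indicator (measurableSet_inducesPattern π)).sub measurable_const
  have hyb : ∀ π p, |y π p| ≤ 1 := fun π p => by
    have := hd0 π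
    have := hd1 π
    simp only [y, Set.indicator_apply]
    split_ifs <;> rw [abs_le] <;> constructor <;> linarith
  have hy0 : ∀ π, ∫ p, y π p ∂(Measure.pi fun _ : Fin π.1 => Γ.measure) = 0 := fun π => by
    simp only [y]
    rw [integral_sub _ (integrable_const _), integral_indicator_const _
      (measurableSet_inducesPattern π), integral_const]
    · simp [Permuton.density]
    · exact (integrable_const _).indicator (measurableSet_inducesPattern π)
  let Y : ∀ π : Permutation, (Fin N → unitInterval × unitInterval) → ℝ := fun π ω =>
    ∑ e : Fin π.1 → Fin N, y π fun a => ω (e a)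
  have hYm : ∀ π, Measurable (Y π) := fun π => by
    refine Finset.measurable_sum _ fun e _ => ?_
    exact (hym π).comp (measurable_pi_lambda _ fun a => measurable_pi_apply _)
  have hYi : ∀ π, Integrable (fun ω => Y π ω ^ 2 / (N : ℝ) ^ (2 * π.1))
      (Measure.pi fun _ : Fin N => Γ.measure) := fun π => by
    refine Integrable.div_const ?_ _
    refine Integrable.of_bound ((hYm π).pow_const 2).aestronglyMeasurable
      ((∑ _e : Fin π.1 → Fin N, (1 : ℝ)) ^ 2) (Eventually.of_forall fun ω => ?_)
    rw [Real.norm_eq_abs, abs_pow]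
    refine pow_le_pow_left₀ (abs_nonneg _) ?_ 2
    exact (Finset.abs_sum_le_sum_abs _ _).trans (Finset.sum_le_sum fun e _ => hyb π _)
  have hint : ∫ ω, ∑ π ∈ T, Y π ω ^ 2 / (N : ℝ) ^ (2 * π.1)
      ∂(Measure.pi fun _ : Fin N => Γ.measure) < ε ^ 2 := by
    rw [integral_finsetSum _ fun π _ => hYi π]
    refine lt_of_le_of_lt (Finset.sum_le_sum fun π _ => ?_) hN1
    rw [integral_div]
    have h1 := integral_sq_sum_le Γ.measure (N := N) (hym π) (hyb π) (hy0 π)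
    calc _ ≤ ((N : ℝ) ^ (2 * π.1) - (N.descFactorial (2 * π.1) : ℝ)) / (N : ℝ) ^ (2 * π.1) :=
          div_le_div_of_nonneg_right h1 (by positivity)
      _ = _ := by rw [sub_div, div_self (by positivity)]
  -- A sample off the null set of coinciding coordinates at which the sum is at most its mean.
  obtain ⟨ω, hω1, hω2⟩ := exists_notMem_null_le_integral
    (integrable_finsetSum T fun π _ => hYi π) (ae_iff.1 (Γ.ae_injective N))
  rw [Set.mem_ofPred_eq, not_not] at hω1
  obtain ⟨σ, hσ⟩ := exists_inducesPattern hω1.1 hω1.2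
  refine ⟨⟨N, σ⟩, hN2, fun π hπ => ?_⟩
  have hπT : π ∈ T := by rw [hT, Set.Finite.mem_toFinset]; exact hπ
  have h1 : Y π ω ^ 2 / (N : ℝ) ^ (2 * π.1) < ε ^ 2 :=
    (Finset.single_le_sum (f := fun π => Y π ω ^ 2 / (N : ℝ) ^ (2 * π.1))
      (fun π _ => by positivity) hπT).trans_lt (hω2.trans_lt hint)
  have hpos : (0 : ℝ) < (N : ℝ) ^ π.1 := by positivity
  have h2 : (Y π ω / (N : ℝ) ^ π.1) ^ 2 < ε ^ 2 := by
    rw [div_pow, ← pow_mul, mul_comm π.1 2]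
    exact h1
  have h3 := (abs_lt.1 (abs_lt_of_sq_lt_sq h2 hε.le)).1
  rw [lt_div_iff₀ hpos] at h3
  have h4 : Y π ω = ({e : Fin π.1 → Fin N | InducesPattern π fun a => ω (e a)}.ncard : ℝ) -
      (N : ℝ) ^ π.1 * Γ.density π := by
    simp only [Y, y]
    rw [Finset.sum_sub_distrib, Set.ncard_eq_toFinset_card', Set.toFinset_ofPred]
    simp [Set.indicator_apply]
  have h5 : ({e : Fin π.1 → Fin N | InducesPattern π fun a => ω (e a)}.ncard : ℝ) ≤
      π.1.factorial * occ π ⟨N, σ⟩ := by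
    exact_mod_cast ncard_inducesPattern_le hσ π
  rw [mul_div_assoc', div_le_iff₀ (by positivity)]
  change (Γ.density π - ε) * (N : ℝ) ^ π.1 ≤ _
  linarith

/-! ### From lower bounds to convergence -/

theorem chooseAt_pos {f : ℝ} {n k : ℕ} (hf : (k : ℝ) ≤ f) (hn : k ≤ n) : 0 < chooseAt f n k := by
  rw [chooseAt_eq ((Nat.cast_nonneg k).trans hf), Set.ncard_pos]
  refine ⟨Fin.castLE hn, Fin.strictMono_castLE hn, fun a b => ?_⟩
  have h1 : ((b : ℕ) : ℝ) + 1 ≤ k := by exact_mod_cast b.2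
  have h2 : (0 : ℝ) ≤ (a : ℕ) := Nat.cast_nonneg _
  rw [Fin.val_castLE, Fin.val_castLE]
  linarith

theorem sum_densityAt {f : ℝ} {k : ℕ} {σ : Permutation} (hf : (k : ℝ) ≤ f) (hn : k ≤ σ.1) :
    ∑ π : Equiv.Perm (Fin k), densityAt f ⟨k, π⟩ σ = 1 := by
  have h := chooseAt_pos hf hn
  change ∑ π : Equiv.Perm (Fin k), (occAt f ⟨k, π⟩ σ : ℝ) / (chooseAt f σ.1 k : ℝ) = 1
  rw [← Finset.sum_div, ← Nat.cast_sum, sum_occAt ((Nat.cast_nonneg k).trans hf)]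
  exact div_self (Nat.cast_ne_zero.2 h.ne')

theorem chooseAt_length (n k : ℕ) : chooseAt n n k = n.choose k := by
  unfold chooseAt
  have h : {K : Finset (Fin n) | K.card = k ∧ (width K : ℝ) ≤ n} =
      (Finset.powersetCard k (Finset.univ : Finset (Fin n)) : Set (Finset (Fin n))) := by
    ext K
    simp only [Set.mem_ofPred_eq, Finset.mem_coe, Finset.mem_powersetCard_univ,
      and_iff_left_iff_imp]
    intro _
    rw [Nat.cast_le, width_le_nat_iff]
    intro x _ y _
    have := y.2
    omega
  rw [h, Set.ncard_coe_finset, Finset.card_powersetCard, Finset.card_univ, Fintype.card_fin]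

theorem densityAt_length (π σ : Permutation) : densityAt σ.1 π σ = density π σ := by
  unfold densityAt density
  rw [chooseAt_length, occAt_eq_occ le_rfl]

theorem le_div_of_mul_le_of_le {a b c o : ℝ} (h : a * b ≤ o) (hcb : c ≤ b) (hc : 0 < c)
    (ho : 0 ≤ o) : a ≤ o / c := by
  rcases le_or_gt a 0 with ha | ha
  · exact ha.trans (div_nonneg ho hc.le)
  · rw [le_div_iff₀ hc]
    exact (mul_le_mul_of_nonneg_left hcb ha.le).trans h

/-- The normalisation in `ScaleGood` bounds the number of sets of width at most `w` from above, so
dividing by the true number only helps. -/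
theorem ScaleGood.le_densityAt {K : ℕ} {ε w : ℝ} {Ξ : Permutation → ℝ} {P π : Permutation}
    (h : ScaleGood K ε w Ξ P) (h1 : 1 ≤ π.1) (h2 : π.1 ≤ K) (hw : (π.1 : ℝ) ≤ w)
    (hn : π.1 ≤ P.1) : Ξ π - ε ≤ densityAt w π P := by
  have h3 := h π h1 h2
  rw [mul_assoc] at h3
  refine le_div_of_mul_le_of_le h3 ?_ (Nat.cast_pos.2 (chooseAt_pos hw hn)) (Nat.cast_nonneg _)
  have h4 := chooseAt_le ((Nat.cast_nonneg _).trans hw) P.1 (π.1 - 1)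
  rw [Nat.sub_add_cancel h1] at h4
  linarith

theorem LocalGood.le_localDensity {K : ℕ} {ε : ℝ} {X : Permutation → ℝ} {P π : Permutation}
    (h : LocalGood K ε X P) (h1 : 1 ≤ π.1) (h2 : π.1 ≤ K) (hn : π.1 ≤ P.1) :
    X π - ε ≤ localDensity π P := by
  refine le_div_of_mul_le_of_le (h π h1 h2) ?_ (Nat.cast_pos.2 (chooseAt_pos le_rfl hn))
    (Nat.cast_nonneg _)
  have h4 := chooseAt_le_choose (f := (π.1 : ℝ)) (Nat.cast_nonneg _) P.1 (π.1 - 1)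
  rw [Nat.sub_add_cancel h1, Nat.floor_natCast, Nat.choose_self, mul_one] at h4
  exact_mod_cast h4

/-- Lower bounds suffice for the convergence of a sequence of probability vectors. -/
theorem tendsto_of_lower_bound {k : ℕ} {L : Permutation → ℝ} {x : ℕ → Permutation → ℝ}
    (hL : ∑ π : Equiv.Perm (Fin k), L ⟨k, π⟩ = 1)
    (hx : ∀ᶠ j in atTop, ∑ π : Equiv.Perm (Fin k), x j ⟨k, π⟩ = 1)
    (hlow : 1 ≤ k → ∀ᶠ j : ℕ in atTop, ∀ π : Equiv.Perm (Fin k),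
      L ⟨k, π⟩ - 1 / ((j : ℝ) + 1) ≤ x j ⟨k, π⟩) (π : Equiv.Perm (Fin k)) :
    Tendsto (fun j => x j ⟨k, π⟩) atTop (𝓝 (L ⟨k, π⟩)) := by
  classical
  -- The empty pattern, excluded from the lower bounds, is the only one of length 0, so the sum is
  -- its value.
  rcases Nat.eq_zero_or_pos k with rfl | hk
  · rw [Fintype.sum_subsingleton _ π] at hL
    rw [hL]
    refine tendsto_const_nhds.congr' ?_
    filter_upwards [hx] with j hj
    rw [Fintype.sum_subsingleton _ π] at hj
    exact hj.symm
  · have hy : ∀ π : Equiv.Perm (Fin k),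
        Tendsto (fun j : ℕ => L ⟨k, π⟩ - 1 / ((j : ℝ) + 1)) atTop (𝓝 (L ⟨k, π⟩)) := fun π => by
      have := (tendsto_const_nhds (x := L ⟨k, π⟩)).sub
        (tendsto_one_div_add_atTop_nhds_zero_nat (𝕜 := ℝ))
      rwa [sub_zero] at this
    -- The upper bound for one pattern is 1 minus the lower bounds for all the others.
    have hup : Tendsto (fun j : ℕ => 1 - ∑ π' ∈ Finset.univ.erase π,
        (L ⟨k, π'⟩ - 1 / ((j : ℝ) + 1))) atTop (𝓝 (L ⟨k, π⟩)) := by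
      have h1 := (tendsto_const_nhds (x := (1 : ℝ))).sub
        (tendsto_finsetSum (Finset.univ.erase π) fun π' _ => hy π')
      have h2 := Finset.add_sum_erase Finset.univ (fun π => L ⟨k, π⟩) (Finset.mem_univ π)
      rw [hL] at h2
      rwa [← h2, add_sub_cancel_right, h2] at h1
    refine tendsto_of_tendsto_of_tendsto_of_le_of_le' (hy π) hup ?_ ?_
    · filter_upwards [hlow hk] with j hj using hj π
    · filter_upwards [hlow hk, hx] with j hj hj'
      have h2 := Finset.add_sum_erase Finset.univ (fun π => x j ⟨k, π⟩) (Finset.mem_univ π)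
      rw [hj'] at h2
      have h3 := Finset.sum_le_sum fun π' (_ : π' ∈ Finset.univ.erase π) => hj π'
      linarith

theorem IsScaleLimit.sum_eq_one {Ξ : Permutation → ℝ} (h : IsScaleLimit Ξ) (k : ℕ) :
    ∑ π : Equiv.Perm (Fin k), Ξ ⟨k, π⟩ = 1 := by
  obtain ⟨f, σ, hf, hl, hσ⟩ := h
  have hl : Tendsto (fun j => (σ j).1) atTop atTop := hl
  have h1 := tendsto_finsetSum (Finset.univ : Finset (Equiv.Perm (Fin k))) fun π _ => hσ ⟨k, π⟩
  refine tendsto_nhds_unique h1 (tendsto_const_nhds.congr' ?_)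
  filter_upwards [(hf.tendsto_atTop.comp hl).eventually_ge_atTop (k : ℝ),
    hl.eventually_ge_atTop k] with j hj1 hj2
  exact (sum_densityAt hj1 hj2).symm

/-- The global level is one more inflation, of a sample `G` of `Γ`, with the length itself in the
role of the next larger scale. -/
theorem exists_allGood_and_occ {f : ℕ → ℕ → ℝ} (hf : ∀ t, IsScalingFunction (f t))
    (hdom : ∀ s t, s ≠ t → Dominated (f s) (f t) ∨ Dominated (f t) (f s))
    {Ξ Ξ' : ℕ → Permutation → ℝ} (hΞ : ∀ t, IsScaleLimit (Ξ t)) (hΞ' : ∀ t, IsScaleLimit (Ξ' t))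
    (Γ : Permuton) (Λ Λ' : SIRIRP) (F : Finset ℕ) (K n₀ : ℕ) {ε : ℝ} (hε : 0 < ε) :
    ∃ τ : Permutation, n₀ ≤ τ.1 ∧
      AllGood F K ε (fun t => f t τ.1) Λ.density Λ'.density Ξ Ξ' τ ∧
      ∀ π : Permutation, π.1 ≤ K →
        (Γ.density π - ε) * ((τ.1 : ℝ) ^ π.1 / π.1.factorial) ≤ occ π τ := by
  set δ : ℝ := min ε 1 / 2 with hδdef
  have hδ0 : 0 < δ := by positivity
  have hδ1 : δ ≤ 1 := by
    have := min_le_right ε 1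
    linarith
  have hδε : δ + δ ≤ ε := by
    have := min_le_left ε 1
    linarith
  obtain ⟨G, hG, hGocc⟩ := Γ.exists_occ_ge K hε
  have hG0 : (0 : ℝ) < G.1 := by exact_mod_cast hG
  have hloc : ∀ ε > 0, ∃ P : Permutation, 0 < P.1 ∧ LocalGood K ε Λ.density P ∧
      LocalGood K ε Λ'.density P.inverse := by
    intro ε hε
    obtain ⟨A, hA0, hA⟩ := Λ.exists_localGood K hε
    obtain ⟨B, hB0, hB⟩ := Λ'.exists_localGood K hε
    exact ⟨grid A B, Nat.mul_pos hB0 hA0, LocalGood.grid hA hB⟩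
  have hev := eventually_exists_allGood hf hdom hΞ hΞ' Λ.density_le_one Λ'.density_le_one K hloc
    F.card F rfl (fun n => (n : ℝ)) tendsto_natCast_atTop_atTop
    (fun t _ => (hf t).dominated_id) (δ / G.1) (by positivity)
  -- Only lengths divisible by `|G|` are used, so that the result has exactly the length at which
  -- the scales were evaluated.
  have hmul : Tendsto (fun u : ℕ => G.1 * u) atTop atTop :=
    tendsto_id.const_mul_atTop' hG
  obtain ⟨u, ⟨P, hP, hPle, hPg⟩, hu1, hu2⟩ := ((hmul.eventually hev).and
    ((hmul.eventually_ge_atTop n₀).and (eventually_ge_atTop 1))).exists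
  have hn1 : 1 ≤ G.1 * u := Nat.mul_pos hG hu2
  have hwpos : ∀ t, 0 ≤ f t (G.1 * u) := fun t => ((hf t).pos _ hn1).le
  have hPu : (P.1 : ℝ) ≤ δ * u := by
    refine hPle.trans (le_of_eq ?_)
    push_cast
    field_simp
  have hG1 : (1 : ℝ) ≤ G.1 := by exact_mod_cast hG
  have hall := ((hPg.mono hwpos (div_le_self hδ0.le hG1)).inflate_padTo Λ.density_le_one
    Λ'.density_le_one (fun t => (hΞ t).le_one) (fun t => (hΞ' t).le_one) hwpos hδ0.le hδ0.le hδ1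
    hP G hPu).mono hwpos hδε
  refine ⟨inflate G (padTo P u), ?_, ?_, fun π hπ => ?_⟩
  · rw [inflate_padTo_fst]
    exact hu1
  · rw [inflate_padTo_fst]
    exact hall
  · have h1 := pow_mul_occAt_le_inflate G (padTo P u) (v := (G.1 : ℝ)) (Nat.cast_nonneg _)
      le_rfl π
    rw [occAt_eq_occ le_rfl, occAt_eq_occ (by rw [inflate_padTo_fst, padTo_fst]; push_cast; rfl),
      padTo_fst] at h1
    have h2 : ((u ^ π.1 * occ π G : ℕ) : ℝ) ≤ occ π (inflate G (padTo P u)) := Nat.cast_le.2 h1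
    refine le_trans ?_ h2
    push_cast
    refine le_trans (le_of_eq ?_) (mul_le_mul_of_nonneg_left (hGocc π hπ)
      (pow_nonneg (Nat.cast_nonneg u) _))
    rw [inflate_padTo_fst]
    push_cast
    ring

theorem convergesAtScale_of_scaleGood {f : ℕ → ℝ} (hf : IsScalingFunction f)
    {Ξ : Permutation → ℝ} (hΞ : IsScaleLimit Ξ) {τ : ℕ → Permutation}
    (hτ : LengthsTendToInfinity τ)
    (h : ∀ᶠ j in atTop, ScaleGood j (1 / ((j : ℝ) + 1)) (f (τ j).1) Ξ (τ j)) :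
    ConvergesAtScale f τ Ξ := by
  refine ⟨hτ, ?_⟩
  have hl : Tendsto (fun j => (τ j).1) atTop atTop := hτ
  have hfl := hf.tendsto_atTop.comp hl
  rintro ⟨k, π⟩
  refine tendsto_of_lower_bound (x := fun j π => densityAt (f (τ j).length) π (τ j))
    (hΞ.sum_eq_one k) ?_ ?_ π
  · filter_upwards [hfl.eventually_ge_atTop (k : ℝ), hl.eventually_ge_atTop k] with j hj1 hj2
    exact sum_densityAt hj1 hj2
  · intro hk
    filter_upwards [hfl.eventually_ge_atTop (k : ℝ), hl.eventually_ge_atTop k,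
      eventually_ge_atTop k, h] with j hj1 hj2 hj3 hj4 π
    exact hj4.le_densityAt (π := ⟨k, π⟩) hk hj3 hj1 hj2

theorem convergesLocally_of_localGood (Λ : SIRIRP) {τ : ℕ → Permutation}
    (hτ : LengthsTendToInfinity τ)
    (h : ∀ j, LocalGood j (1 / ((j : ℝ) + 1)) Λ.density (τ j)) : ConvergesLocally τ Λ := by
  refine ⟨hτ, ?_⟩
  have hl : Tendsto (fun j => (τ j).1) atTop atTop := hτ
  rintro ⟨k, π⟩
  refine tendsto_of_lower_bound (x := fun j π => localDensity π (τ j)) (Λ.sum_density k) ?_ ?_ π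
  · filter_upwards [hl.eventually_ge_atTop k] with j hj
    exact sum_densityAt (f := (k : ℝ)) le_rfl hj
  · intro hk
    filter_upwards [hl.eventually_ge_atTop k, eventually_ge_atTop k] with j hj1 hj2 π
    exact (h j).le_localDensity (π := ⟨k, π⟩) hk hj2 hj1

theorem convergesGlobally_of_occ_ge (Γ : Permuton) {τ : ℕ → Permutation}
    (hτ : LengthsTendToInfinity τ)
    (h : ∀ j, ∀ π : Permutation, π.1 ≤ j →
      (Γ.density π - 1 / ((j : ℝ) + 1)) * (((τ j).1 : ℝ) ^ π.1 / π.1.factorial) ≤ occ π (τ j)) :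
    ConvergesGlobally τ Γ := by
  refine ⟨hτ, ?_⟩
  have hl : Tendsto (fun j => (τ j).1) atTop atTop := hτ
  rintro ⟨k, π⟩
  refine tendsto_of_lower_bound (x := fun j π => density π (τ j)) (Γ.sum_density k) ?_ ?_ π
  · filter_upwards [hl.eventually_ge_atTop k] with j hj
    have := sum_densityAt (f := ((τ j).1 : ℝ)) (Nat.cast_le.2 hj) hj
    simpa only [densityAt_length] using this
  · intro hk
    filter_upwards [hl.eventually_ge_atTop k, eventually_ge_atTop k] with j hj1 hj2 π
    exact le_div_of_mul_le_of_le (h j ⟨k, π⟩ hj2) (Nat.choose_le_pow_div k _)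
      (Nat.cast_pos.2 (Nat.choose_pos hj1)) (Nat.cast_nonneg _)

end PermScale

theorem mainTheorem2
    (f : ℕ → ℕ → ℝ)
    (hf : ∀ t, PermScale.IsScalingFunction (f t))
    (hdom : ∀ s t, s ≠ t → PermScale.Dominated (f s) (f t) ∨ PermScale.Dominated (f t) (f s))
    (Ξ Ξ' : ℕ → PermScale.Permutation → ℝ)
    (hΞ : ∀ t, PermScale.IsScaleLimit (Ξ t))
    (hΞ' : ∀ t, PermScale.IsScaleLimit (Ξ' t))
    (Γ : PermScale.Permuton)
    (Λ Λ' : PermScale.SIRIRP) :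
    ∃ τ : ℕ → PermScale.Permutation,
      (∀ t, PermScale.ConvergesAtScale (f t) τ (Ξ t)) ∧
      PermScale.ConvergesGlobally τ Γ ∧
      PermScale.ConvergesLocally τ Λ ∧
      (∀ t, PermScale.ConvergesAtScale (f t) (fun j => (τ j).inverse) (Ξ' t)) ∧
      PermScale.ConvergesLocally (fun j => (τ j).inverse) Λ' := by
  -- Diagonal choice: the `j`th term treats the scales `t < j` and patterns of length at most `j`
  -- with error `1 / (j + 1)`, so every scale is covered from some term on.
  choose τ hlen hgood hocc using fun j : ℕ => PermScale.exists_allGood_and_occ hf hdom hΞ hΞ'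
    Γ Λ Λ' (Finset.range j) j j (show (0 : ℝ) < 1 / ((j : ℝ) + 1) by positivity)
  have hτ : PermScale.LengthsTendToInfinity τ := tendsto_atTop_mono hlen tendsto_id
  refine ⟨τ, fun t => ?_, PermScale.convergesGlobally_of_occ_ge Γ hτ hocc,
    PermScale.convergesLocally_of_localGood Λ hτ fun j => (hgood j).loc, fun t => ?_,
    PermScale.convergesLocally_of_localGood Λ' hτ fun j => (hgood j).locInv⟩
  · refine PermScale.convergesAtScale_of_scaleGood (hf t) (hΞ t) hτ ?_
    filter_upwards [eventually_gt_atTop t] with j hj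
    exact (hgood j).scale t (Finset.mem_range.2 hj)
  · refine PermScale.convergesAtScale_of_scaleGood (hf t) (hΞ' t) hτ ?_
    filter_upwards [eventually_gt_atTop t] with j hj
    exact (hgood j).scaleInv t (Finset.mem_range.2 hj)
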